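/- **Setting.** Let $\Lambda\subset\mathbb Z^r$ be a finite set of sites with one qubit per site, $|x-y|$ the Euclidean distance and $\|\cdot\|$ the operator norm. Fix $k\in\mathbb N$ and $g,\kappa\in\mathbb R$. Let $H=\sum_{Z\subseteq\Lambda}h_Z$, where each $h_Z$ is Hermitian, acts nontrivially only on $Z$, satisfies $\|h_Z\|\le g$, and vanishes unless $Z$ has diameter at most $k$. Let $A_1,\dots,A_J$ be jump operators such that $A_a$ acts nontrivially only on a set $X_a\subseteq\Lambda$ of at most $k$ sites and $\|A_a\|\le g$. For $\beta>0$ put $A(t)=e^{iHt}Ae^{-iHt}$ and $$\hat A_a(\omega)=\frac1{\sqrt{2\pi}}\int_{\mathbb R}\frac{e^{-t^2/\beta^2}}{\sqrt{\beta\sqrt{\pi/2}}}\,e^{-i\omega t}A_a(t)\,dt,\qquad \gamma(\omega)=e^{-(\beta\omega+1)^2/2},$$ $$G_a=\int_{\mathbb R}\!\int_{\mathbb R} b_1(t)\,b_2(t')\;e^{-i\beta Ht}\,A_a^\dagger(\beta t')\,A_a(-\beta t')\,e^{i\beta Ht}\,dt'\,dt,$$ $$b_1(t)=\int_{\mathbb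 R}\frac{\sin(s-t)\,e^{-2(s-t)^2}}{\cosh(2\pi s)}\,ds,\qquad b_2(t')=\frac{e^{1/8}}{\pi}e^{-4t'^2-2it'}.$$ The Lindbladian of Chen, Kastoryano and Gilyén is $$\mathcal L(\rho)=-i\,\kappa\Big[\sum_{a=1}^J G_a,\rho\Big]+\sum_{a=1}^J\int_{\mathbb R}\gamma(\omega)\Big(\hat A_a(\omega)\rho\hat A_a(\omega)^\dagger-\tfrac12\{\hat A_a(\omega)^\dagger\hat A_a(\omega),\rho\}\Big)d\omega ;$$ for $\kappa=2$ and a family $(A_a)$ closed under adjoints it satisfies $\mathcal L(e^{-\beta H})=0$. Call an operator *$R$-local* if for some $a$ it acts nontrivially only on the radius-$R$ neighbourhood $\{y\in\Lambda:\exists x\in X_a,\ |x-y|\le R\}$ of $X_a$. **Statement.** There is a constant $C>0$ depending only on $r,k,g,\kappa$ such that for all $\Lambda$, $H$, $J$, $(A_a)$ as above, all $\beta>0$ and all $\epsilon>0$ with $J/\epsilon\ge 2$, the following holds with $$R=C(\beta+1)\log\frac J\epsilon .$$ 1. There is a Lindbladian $$\mathcal E(\rho)=-i\Big[\sum_j B_j,\rho\Big]+\sum_i\Big(L_i\rho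 L_i^\dagger-\tfrac12\{L_i^\dagger L_i,\rho\}\Big)$$ with finitely many Hermitian $B_j$ and finitely many $L_i$, all of them $R$-local, such that $\|\mathcal L-\mathcal E\|_\diamond\le\epsilon$. 2. For all sufficiently small $\delta>0$ there is a quantum channel $\mathcal E_\delta(\rho)=\sum_i K_i\rho K_i^\dagger$ with finitely many Kraus operators, $\sum_iK_i^\dagger K_i=I$, all of them $R$-local, such that $\|(\mathrm{id}+\delta\mathcal L)-\mathcal E_\delta\|_\diamond\le\delta\epsilon$. -/

import Mathlib

open MeasureTheory
open scoped Matrix ENNReal Matrix.Norms.L2Operator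

noncomputable section

namespace QGibbs

/-! ### Qubits on a finite piece of the lattice `ℤ^r` -/

/-- Computational basis configurations: one qubit on every site of the finite region `Λ ⊆ ℤ^r`. -/
abbrev Config {r : ℕ} (Λ : Finset (Fin r → ℤ)) : Type := Λ → Fin 2

/-- Operators on the Hilbert space of the qubits on `Λ`, written in the computational basis.
They carry the operator norm of `ℂ^(2^|Λ|)` with its Euclidean structure. -/
abbrev Op {r : ℕ} (Λ : Finset (Fin r → ℤ)) : Type := Matrix (Config Λ) (Config Λ) ℂ

/-- Euclidean distance between lattice sites. -/
def latDist {r : ℕ} (x y : Fin r → ℤ) : ℝ := √(∑ i, ((x i : ℝ) - (y i : ℝ)) ^ 2)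

/-- `M` acts nontrivially only on the qubits in `S`: it is `N ⊗ 1` for an operator `N` on the
qubits in `S`, the identity being taken on all the other qubits. -/
def ActsOn {r : ℕ} {Λ : Finset (Fin r → ℤ)} (M : Op Λ) (S : Set Λ) : Prop :=
  ∃ N : Matrix (S → Fin 2) (S → Fin 2) ℂ, ∀ σ τ : Config Λ,
    ((∀ x, x ∉ S → σ x = τ x) → M σ τ = N (fun x => σ x) (fun x => τ x)) ∧
    ((∃ x, x ∉ S ∧ σ x ≠ τ x) → M σ τ = 0)

/-- The neighbourhood of radius `R` of a set `X` of sites. -/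
def nbhd {r : ℕ} {Λ : Finset (Fin r → ℤ)} (R : ℝ) (X : Finset Λ) : Set Λ :=
  {y | ∃ x ∈ X, latDist (x : Fin r → ℤ) (y : Fin r → ℤ) ≤ R}

/-- `h` is the family of terms of a constant-local lattice Hamiltonian `H = ∑_Z h_Z`: each `h_Z` is
Hermitian, acts only on `Z`, has norm at most `g`, and vanishes if `Z` has diameter above `k`. -/
structure IsLocalInteraction {r : ℕ} {Λ : Finset (Fin r → ℤ)} (k : ℕ) (g : ℝ)
    (h : Finset Λ → Op Λ) : Prop where
  isHermitian : ∀ Z, (h Z).IsHermitian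
  actsOn : ∀ Z, ActsOn (h Z) (Z : Set Λ)
  diam_le : ∀ Z, h Z ≠ 0 → ∀ x ∈ Z, ∀ y ∈ Z,
    latDist (x : Fin r → ℤ) (y : Fin r → ℤ) ≤ k
  norm_le : ∀ Z, ‖h Z‖ ≤ g

/-- `A` is a family of `J` constant-local jump operators: `A a` acts only on the set `X a` of at
most `k` sites and has norm at most `g`. -/
structure IsLocalJumps {r : ℕ} {Λ : Finset (Fin r → ℤ)} (k : ℕ) (g : ℝ) {J : ℕ}
    (X : Fin J → Finset Λ) (A : Fin J → Op Λ) : Prop where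
  card_le : ∀ a, (X a).card ≤ k
  actsOn : ∀ a, ActsOn (A a) (X a : Set Λ)
  norm_le : ∀ a, ‖A a‖ ≤ g

/-! ### Superoperators: diamond norm, Kraus form, Lindblad form -/

section Superoperators

variable {n : Type*} [Fintype n] [DecidableEq n]

/-- Trace norm: the sum of the singular values. -/
def traceNorm (X : Matrix n n ℂ) : ℝ :=
  ∑ i, √((Matrix.isHermitian_conjTranspose_mul_self X).eigenvalues i)

/-- `Φ ⊗ id` for an `m`-dimensional ancilla: `Φ` is applied to each of the `m²` blocks. -/
def amplify (Φ : Matrix n n ℂ → Matrix n n ℂ) (m : ℕ)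
    (X : Matrix (n × Fin m) (n × Fin m) ℂ) : Matrix (n × Fin m) (n × Fin m) ℂ :=
  Matrix.of fun u v => Φ (Matrix.of fun i j => X (i, u.2) (j, v.2)) u.1 v.1

/-- Diamond norm: the supremum of `‖(Φ ⊗ id)(X)‖₁` over all ancilla dimensions and all `X` with
`‖X‖₁ ≤ 1`. -/
def diamondNorm (Φ : Matrix n n ℂ → Matrix n n ℂ) : ℝ≥0∞ :=
  ⨆ (m : ℕ) (X : Matrix (n × Fin m) (n × Fin m) ℂ) (_ : traceNorm X ≤ 1),
    ENNReal.ofReal (traceNorm (amplify Φ m X))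

/-- The map `ρ ↦ ∑ i, K i ρ (K i)†`; it is a quantum channel iff `∑ i, (K i)† (K i) = 1`. -/
def krausMap {q : ℕ} (K : Fin q → Matrix n n ℂ) (ρ : Matrix n n ℂ) : Matrix n n ℂ :=
  ∑ i, K i * ρ * (K i)ᴴ

/-- `L ρ L† - ½ {L† L, ρ}`. -/
def dissipator (L ρ : Matrix n n ℂ) : Matrix n n ℂ :=
  L * ρ * Lᴴ - (1 / 2 : ℂ) • (Lᴴ * L * ρ + ρ * (Lᴴ * L))

/-- `ρ ↦ -i [∑ j, B j, ρ] + ∑ i, (L i ρ (L i)† - ½ {(L i)† L i, ρ})`. -/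
def lindbladian {p q : ℕ} (B : Fin p → Matrix n n ℂ) (L : Fin q → Matrix n n ℂ)
    (ρ : Matrix n n ℂ) : Matrix n n ℂ :=
  -Complex.I • ((∑ j, B j) * ρ - ρ * ∑ j, B j) + ∑ i, dissipator (L i) ρ

/-! ### The Lindbladian of Chen, Kastoryano and Gilyén -/

/-- Heisenberg evolution `A(t) = exp(iHt) A exp(-iHt)`. -/
def evolve (H : Matrix n n ℂ) (t : ℝ) (A : Matrix n n ℂ) : Matrix n n ℂ :=
  NormedSpace.exp ((Complex.I * t) • H) * A * NormedSpace.exp ((-(Complex.I * t)) • H)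

/-- The Gaussian filter, of width `β` and normalised in `L²(ℝ)`. -/
def gaussFilter (β t : ℝ) : ℝ :=
  Real.exp (-(t ^ 2 / β ^ 2)) / √(β * √(Real.pi / 2))

/-- The Gaussian transition weight `γ(ω)`. -/
def transWeight (β ω : ℝ) : ℝ := Real.exp (-((β * ω + 1) ^ 2 / 2))

/-- The operator Fourier transform `(2π)^(-1/2) ∫ f(t) e^(-iωt) A(t) dt` of a jump operator. -/
def jumpFourier (H : Matrix n n ℂ) (β ω : ℝ) (A : Matrix n n ℂ) : Matrix n n ℂ :=
  (1 / √(2 * Real.pi) : ℂ) •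
    ∫ t : ℝ, ((gaussFilter β t : ℂ) * Complex.exp (-(Complex.I * ω * t))) • evolve H t A

/-- `b₁(t) = ∫ sin(s - t) exp(-2 (s - t)²) / cosh(2πs) ds`. -/
def cohOuter (t : ℝ) : ℝ :=
  ∫ s : ℝ, Real.sin (s - t) * Real.exp (-(2 * (s - t) ^ 2)) / Real.cosh (2 * Real.pi * s)

/-- `b₂(t) = (e^(1/8) / π) exp(-4t² - 2it)`. -/
def cohInner (t : ℝ) : ℂ :=
  (Real.exp (1 / 8) / Real.pi : ℂ) * Complex.exp (-(4 * t ^ 2) - 2 * Complex.I * t)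

/-- The coherent term `∫∫ b₁(t) b₂(t') e^(-iβHt) A†(βt') A(-βt') e^(iβHt) dt' dt` of a jump
operator. -/
def coherentTerm (H : Matrix n n ℂ) (β : ℝ) (A : Matrix n n ℂ) : Matrix n n ℂ :=
  ∫ t : ℝ, (cohOuter t : ℂ) • evolve H (-(β * t))
    (∫ t' : ℝ, cohInner t' • (evolve H (β * t') Aᴴ * evolve H (-(β * t')) A))

/-- The Lindbladian with Hamiltonian `H`, inverse temperature `β` and jump operators `A`. The
coherent part carries a real weight `κ`; the Gibbs state is stationary for every family `A` closed
under adjoints when `κ = 2`. -/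
def chenLindbladian {J : ℕ} (κ : ℝ) (H : Matrix n n ℂ) (β : ℝ) (A : Fin J → Matrix n n ℂ)
    (ρ : Matrix n n ℂ) : Matrix n n ℂ :=
  -Complex.I • ((κ : ℂ) • ∑ a, (coherentTerm H β (A a) * ρ - ρ * coherentTerm H β (A a))) +
    ∑ a, ∫ ω : ℝ, (transWeight β ω : ℂ) • dissipator (jumpFourier H β ω (A a)) ρ

end Superoperators

end QGibbs

end

/-! Every ingredient of the generator is an integral of Heisenberg-evolved jump operators `A(βs)`
against a rapidly decaying kernel in the dimensionless time `s`. Replacing the full Hamiltonian by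
the terms supported inside the `R`-neighbourhood of `X a` makes each ingredient exactly local, so
what remains is to bound the cost of this replacement and to bring the result into Lindblad or Kraus
form with finitely many local operators.

The cost comes from a Lieb–Robinson bound. The commutators of `A` with the evolved interaction
terms, weighted by the exponential of the distance to `X a`, are summed and controlled by Grönwall
(`lieb_robinson`). Duhamel's formula turns this into an evolution error `c * exp (v|t| - R)`
(`exists_norm_evolve_sub_evolve_truncHam_le`). This grows too fast in `β|s|` to be integrated
against a kernel uniformly in `β`, so it is interpolated with the trivial bound `2g`:
`norm_evolve_sub_scaled_le` gives growth only `exp |s|` and decay `exp (-R / ((v+1)(β+1)))`. All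
kernels remain integrable after multiplication by `exp |s|`, and the powers of `β` cancel between
filter and transition weight, so `diamondBound_chenTerm_sub` has a constant independent of `β` and
of the system size. Choosing `R` proportional to `(β+1) log(J/ε)` makes the error per jump operator
at most `ε/(2J)`.

The continuum of jump operators becomes finite by diagonalizing the positive matrix `∫ γ(ω)
|L(ω)⟩⟨L(ω)| dω`. Its eigenvectors with nonzero eigenvalue are superpositions of the `L(ω)`, hence
still local (`exists_finite_outerProduct_eq_integral`).

For the channel, a single no-jump Kraus operator for the whole generator would be nonlocal. Instead
each jump operator `a` gets its own channel for the step `δJ`, with exactly trace-preserving no-jump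
operator `exp(-iδJ B) √(1 - δJ D)`, where `D = ∑ L†L`, and these `J` channels are mixed with
probability `1/J` (`exists_noJump_channel`, `exists_lindbladian_and_channel`). Diamond norms are
estimated throughout by trace duality (`DiamondBound`). -/

noncomputable section

namespace QGibbs

/-! ### Unitary propagators and Heisenberg evolution. -/

section Evolution

variable {n : Type*} [Fintype n] [DecidableEq n]

/-- The one-parameter group `exp(iHt)`. -/
def propagator (H : Matrix n n ℂ) (t : ℝ) : Matrix n n ℂ :=
  NormedSpace.exp ((Complex.I * t) • H)

theorem evolve_eq (H A : Matrix n n ℂ) (t : ℝ) :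
    evolve H t A = propagator H t * A * propagator H (-t) := by
  simp [evolve, propagator]

theorem propagator_zero (H : Matrix n n ℂ) : propagator H 0 = 1 := by
  simp [propagator]

theorem propagator_add (H : Matrix n n ℂ) (s t : ℝ) :
    propagator H (s + t) = propagator H s * propagator H t := by
  unfold propagator
  rw [← Matrix.exp_add_of_commute _ _ ((Commute.refl H).smul_left _ |>.smul_right _), ← add_smul]
  push_cast
  rw [mul_add]

theorem propagator_mul_neg (H : Matrix n n ℂ) (t : ℝ) :
    propagator H t * propagator H (-t) = 1 := by
  rw [← propagator_add, add_neg_cancel, propagator_zero]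

theorem propagator_neg_mul (H : Matrix n n ℂ) (t : ℝ) :
    propagator H (-t) * propagator H t = 1 := by
  rw [← propagator_add, neg_add_cancel, propagator_zero]

theorem propagator_neg_left (H : Matrix n n ℂ) (t : ℝ) :
    propagator (-H) t = propagator H (-t) := by
  simp [propagator]

theorem propagator_conjTranspose {H : Matrix n n ℂ} (hH : H.IsHermitian) (t : ℝ) :
    (propagator H t)ᴴ = propagator H (-t) := by
  unfold propagator
  rw [← Matrix.exp_conjTranspose, Matrix.conjTranspose_smul, hH.eq]
  congr 2
  simp

theorem norm_one_le : ‖(1 : Matrix n n ℂ)‖ ≤ 1 := by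
  rcases isEmpty_or_nonempty n with h | h
  · have : (1 : Matrix n n ℂ) = 0 := Subsingleton.elim _ _
    simp [this]
  · exact (CStarRing.norm_one).le

theorem norm_le_one_of_conjTranspose_mul_self {U : Matrix n n ℂ} (h : ‖Uᴴ * U‖ ≤ 1) :
    ‖U‖ ≤ 1 := by
  rw [Matrix.l2_opNorm_conjTranspose_mul_self] at h
  nlinarith [norm_nonneg U]

theorem norm_propagator_le {H : Matrix n n ℂ} (hH : H.IsHermitian) (t : ℝ) :
    ‖propagator H t‖ ≤ 1 := by
  apply norm_le_one_of_conjTranspose_mul_self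
  rw [propagator_conjTranspose hH, propagator_neg_mul]
  exact norm_one_le

theorem hasDerivAt_propagator (H : Matrix n n ℂ) (t : ℝ) :
    HasDerivAt (propagator H) (propagator H t * (Complex.I • H)) t := by
  have h := hasDerivAt_exp_smul_const (𝕂 := ℝ) (Complex.I • H) t
  have e : ∀ s : ℝ, s • Complex.I • H = (Complex.I * s) • H := fun s => by
    rw [mul_comm, ← smul_smul]; rfl
  simp only [e] at h
  exact h

theorem propagator_commute (H : Matrix n n ℂ) (t : ℝ) : Commute (propagator H t) H := by
  unfold propagator
  exact ((Commute.refl H).smul_left _).exp_left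

theorem continuous_propagator (H : Matrix n n ℂ) : Continuous (propagator H) :=
  continuous_iff_continuousAt.2 fun t => (hasDerivAt_propagator H t).continuousAt

theorem continuous_evolve (H A : Matrix n n ℂ) : Continuous fun t => evolve H t A := by
  simp only [evolve_eq]
  have := continuous_propagator H
  fun_prop

theorem norm_evolve_le {H : Matrix n n ℂ} (hH : H.IsHermitian) (t : ℝ) (A : Matrix n n ℂ) :
    ‖evolve H t A‖ ≤ ‖A‖ := by
  rw [evolve_eq]
  calc _ ≤ ‖propagator H t‖ * ‖A‖ * ‖propagator H (-t)‖ := norm_mul₃_le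
    _ ≤ 1 * ‖A‖ * 1 := by
        gcongr
        · exact norm_propagator_le hH t
        · exact norm_propagator_le hH (-t)
    _ = _ := by ring

theorem evolve_zero_time (H A : Matrix n n ℂ) : evolve H 0 A = A := by
  simp [evolve_eq, propagator_zero]

theorem evolve_evolve (H : Matrix n n ℂ) (s t : ℝ) (A : Matrix n n ℂ) :
    evolve H s (evolve H t A) = evolve H (s + t) A := by
  simp only [evolve_eq]
  rw [propagator_add, neg_add_rev, propagator_add]
  noncomm_ring

theorem evolve_mul (H : Matrix n n ℂ) (t : ℝ) (A B : Matrix n n ℂ) :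
    evolve H t (A * B) = evolve H t A * evolve H t B := by
  simp only [evolve_eq]
  calc _ = propagator H t * A * 1 * B * propagator H (-t) := by noncomm_ring
    _ = _ := by rw [← propagator_neg_mul H t]; noncomm_ring

theorem evolve_sub (H : Matrix n n ℂ) (t : ℝ) (A B : Matrix n n ℂ) :
    evolve H t (A - B) = evolve H t A - evolve H t B := by
  simp only [evolve_eq]; noncomm_ring

theorem evolve_smul (H : Matrix n n ℂ) (t : ℝ) (c : ℂ) (A : Matrix n n ℂ) :
    evolve H t (c • A) = c • evolve H t A := by
  simp [evolve_eq]

theorem evolve_sum {ι : Type*} (s : Finset ι) (H : Matrix n n ℂ) (t : ℝ) (A : ι → Matrix n n ℂ) :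
    evolve H t (∑ i ∈ s, A i) = ∑ i ∈ s, evolve H t (A i) := by
  simp [evolve_eq, Finset.mul_sum, Finset.sum_mul]

theorem evolve_conjTranspose {H : Matrix n n ℂ} (hH : H.IsHermitian) (t : ℝ) (A : Matrix n n ℂ) :
    (evolve H t A)ᴴ = evolve H t Aᴴ := by
  simp [evolve_eq, propagator_conjTranspose hH, mul_assoc]

theorem evolve_neg_left (H : Matrix n n ℂ) (t : ℝ) (A : Matrix n n ℂ) :
    evolve (-H) t A = evolve H (-t) A := by
  simp [evolve_eq, propagator_neg_left]

/-- Heisenberg equation of motion. -/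
theorem hasDerivAt_evolve (H A : Matrix n n ℂ) (t : ℝ) :
    HasDerivAt (fun s => evolve H s A) (Complex.I • evolve H t (H * A - A * H)) t := by
  have h1 := hasDerivAt_propagator H t
  have h2 : HasDerivAt (fun s => propagator H (-s)) (-(propagator H (-t) * (Complex.I • H))) t := by
    have h := (hasDerivAt_propagator H (-t)).scomp t (hasDerivAt_neg t)
    rw [neg_one_smul] at h
    exact h
  have h3 := (h1.mul_const A).mul h2
  have e : (fun s => evolve H s A) = fun s => propagator H s * A * propagator H (-s) :=
    funext fun s => evolve_eq H A s
  rw [e, evolve_eq]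
  refine HasDerivAt.congr_deriv h3 ?_
  have hc := (propagator_commute H (-t)).eq
  simp only [mul_sub, sub_mul, Matrix.mul_smul, Matrix.smul_mul, mul_neg, smul_sub, hc]
  simp only [mul_assoc, sub_eq_add_neg]

/-- Conjugating by the unitary shifts the time dependence from one factor to the other. Duhamel
produces commutators with an evolved `A`, while Lieb–Robinson controls those with evolved
interaction terms. -/
theorem norm_commutator_evolve_evolve_le {H : Matrix n n ℂ} (hH : H.IsHermitian) (t : ℝ)
    (A B : Matrix n n ℂ) :
    ‖evolve H t A * B - B * evolve H t A‖ ≤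
      ‖A * evolve H (-t) B - evolve H (-t) B * A‖ := by
  have : evolve H t A * B - B * evolve H t A =
      evolve H t (A * evolve H (-t) B - evolve H (-t) B * A) := by
    simp [evolve_sub, evolve_mul, evolve_evolve, evolve_zero_time]
  rw [this]
  exact norm_evolve_le hH _ _

end Evolution

/-! ### Lieb–Robinson bound and Duhamel estimate. -/

/-- Grönwall's inequality for the `ℓ¹` norm of a finite family. -/
theorem sum_norm_le_of_sum_norm_deriv_le {ι E : Type*} [Fintype ι] [NormedAddCommGroup E]
    [NormedSpace ℝ E] {f f' : ι → ℝ → E} {K : ℝ} (hf : ∀ i t, HasDerivAt (f i) (f' i t) t)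
    (hK : ∀ t, ∑ i, ‖f' i t‖ ≤ K * ∑ i, ‖f i t‖) {t : ℝ} (ht : 0 ≤ t) :
    ∑ i, ‖f i t‖ ≤ (∑ i, ‖f i 0‖) * Real.exp (K * t) := by
  -- The individual norms need not be differentiable, so the family is viewed as one curve in an
  -- `ℓ¹` space, where the vector-valued Grönwall inequality applies.
  let e := (PiLp.continuousLinearEquiv 1 ℝ (fun _ : ι => E)).symm
  let F : ℝ → PiLp 1 (fun _ : ι => E) := fun t => e fun i => f i t
  let F' : ℝ → PiLp 1 (fun _ : ι => E) := fun t => e fun i => f' i t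
  have hF : ∀ t, HasDerivAt F (F' t) t := fun t =>
    e.toContinuousLinearMap.hasFDerivAt.comp_hasDerivAt t (hasDerivAt_pi.2 fun i => hf i t)
  have nF : ∀ t, ‖F t‖ = ∑ i, ‖f i t‖ := fun t => PiLp.norm_eq_of_L1 _
  have nF' : ∀ t, ‖F' t‖ = ∑ i, ‖f' i t‖ := fun t => PiLp.norm_eq_of_L1 _
  have := norm_le_gronwallBound_of_norm_deriv_right_le (f := F) (f' := F') (δ := ‖F 0‖) (K := K)
    (ε := 0) (a := 0) (b := t) (fun s _ => (hF s).continuousAt.continuousWithinAt)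
    (fun s _ => (hF s).hasDerivWithinAt) le_rfl
    (fun s _ => by rw [nF, nF', add_zero]; exact hK s) t ⟨ht, le_rfl⟩
  rwa [gronwallBound_ε0, sub_zero, nF, nF] at this

theorem isHermitian_sum {n ι : Type*} (s : Finset ι) {h : ι → Matrix n n ℂ}
    (hh : ∀ i, (h i).IsHermitian) : (∑ i ∈ s, h i).IsHermitian := by
  unfold Matrix.IsHermitian
  rw [Matrix.conjTranspose_sum]
  exact Finset.sum_congr rfl fun i _ => (hh i).eq

section LiebRobinson

variable {n : Type*} [Fintype n] [DecidableEq n]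

theorem norm_commutator_le (A B : Matrix n n ℂ) : ‖A * B - B * A‖ ≤ 2 * ‖A‖ * ‖B‖ := by
  calc _ ≤ ‖A * B‖ + ‖B * A‖ := norm_sub_le _ _
    _ ≤ ‖A‖ * ‖B‖ + ‖B‖ * ‖A‖ := add_le_add (norm_mul_le _ _) (norm_mul_le _ _)
    _ = _ := by ring

/-- By the Jacobi identity the nested commutator splits into `[[A,P],Q] + [P,[A,Q]]`. This closes
the system of differential inequalities on the commutators of `A` with single terms. -/
theorem norm_nested_commutator_le {A P Q : Matrix n n ℂ} {g : ℝ} (hP : ‖P‖ ≤ g) (hQ : ‖Q‖ ≤ g) :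
    ‖A * (P * Q - Q * P) - (P * Q - Q * P) * A‖ ≤
      2 * g * (‖A * P - P * A‖ + ‖A * Q - Q * A‖) := by
  have e : A * (P * Q - Q * P) - (P * Q - Q * P) * A =
      ((A * P - P * A) * Q - Q * (A * P - P * A)) +
        (P * (A * Q - Q * A) - (A * Q - Q * A) * P) := by noncomm_ring
  rw [e]
  calc _ ≤ _ := norm_add_le _ _
    _ ≤ 2 * ‖A * P - P * A‖ * ‖Q‖ + 2 * ‖P‖ * ‖A * Q - Q * A‖ :=
        add_le_add (norm_commutator_le _ _) (norm_commutator_le _ _)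
    _ ≤ 2 * ‖A * P - P * A‖ * g + 2 * g * ‖A * Q - Q * A‖ := by gcongr
    _ = _ := by ring

/-- Weighted Lieb–Robinson bound for a Hamiltonian `∑ i, h i` whose terms only fail to commute with
the terms in `N i`. -/
theorem lieb_robinson_of_nonneg {ι : Type*} [Fintype ι] [DecidableEq ι] {h : ι → Matrix n n ℂ}
    {g E : ℝ} {Δ : ℕ} {N : ι → Finset ι} {w : ι → ℝ} (hh : ∀ i, (h i).IsHermitian)
    (hg : ∀ i, ‖h i‖ ≤ g) (hN : ∀ i j, j ∉ N i → Commute (h j) (h i))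
    (hsymm : ∀ i j, j ∈ N i → i ∈ N j) (hΔ : ∀ i, (N i).card ≤ Δ) (hg0 : 0 ≤ g) (hE : 0 ≤ E)
    (hw : ∀ i, 0 ≤ w i) (hwE : ∀ i, ∀ j ∈ N i, w i ≤ E * w j) (A : Matrix n n ℂ) {t : ℝ}
    (ht : 0 ≤ t) :
    ∑ i, w i * ‖A * evolve (∑ i, h i) t (h i) - evolve (∑ i, h i) t (h i) * A‖ ≤
      (∑ i, w i * ‖A * h i - h i * A‖) * Real.exp (2 * g * ((E + 1) * Δ) * t) := by
  set H := ∑ i, h i with hHdef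
  have hH : H.IsHermitian := isHermitian_sum _ hh
  let f : ι → ℝ → Matrix n n ℂ := fun i s =>
    w i • (A * evolve H s (h i) - evolve H s (h i) * A)
  let D : ι → ℝ → Matrix n n ℂ := fun i s => Complex.I • evolve H s (H * h i - h i * H)
  let f' : ι → ℝ → Matrix n n ℂ := fun i s => w i • (A * D i s - D i s * A)
  have hf : ∀ i s, HasDerivAt (f i) (f' i s) s := fun i s =>
    HasDerivAt.const_smul (w i) (((hasDerivAt_evolve H (h i) s).const_mul A).sub
      ((hasDerivAt_evolve H (h i) s).mul_const A))
  have nf : ∀ i s, ‖f i s‖ = w i * ‖A * evolve H s (h i) - evolve H s (h i) * A‖ := fun i s => by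
    simp only [f]; rw [norm_smul, Real.norm_of_nonneg (hw i)]
  have hcomm : ∀ i, H * h i - h i * H = ∑ j ∈ N i, (h j * h i - h i * h j) := fun i => by
    rw [hHdef, Finset.sum_mul, Finset.mul_sum, ← Finset.sum_sub_distrib]
    refine (Finset.sum_subset (Finset.subset_univ _) fun j _ hj => ?_).symm
    rw [(hN i j hj).eq, sub_self]
  -- Of the two Jacobi terms, the one in `h i` already carries the weight `w i`. The one in `h j`
  -- needs `w j` instead, which costs the factor `E`.
  have hD : ∀ i s, ‖f' i s‖ ≤ ∑ j ∈ N i, 2 * g * (E * ‖f j s‖ + ‖f i s‖) := fun i s => by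
    have e : A * D i s - D i s * A = Complex.I • ∑ j ∈ N i,
        (A * (evolve H s (h j) * evolve H s (h i) - evolve H s (h i) * evolve H s (h j)) -
          (evolve H s (h j) * evolve H s (h i) - evolve H s (h i) * evolve H s (h j)) * A) := by
      have eD : D i s = Complex.I • ∑ j ∈ N i,
          (evolve H s (h j) * evolve H s (h i) - evolve H s (h i) * evolve H s (h j)) := by
        simp only [D, hcomm, evolve_sum, evolve_sub, evolve_mul]
      rw [eD, mul_smul_comm, smul_mul_assoc, ← smul_sub, Finset.mul_sum, Finset.sum_mul,
        ← Finset.sum_sub_distrib]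
    simp only [f']
    rw [norm_smul, Real.norm_of_nonneg (hw i), e, norm_smul, Complex.norm_I, one_mul]
    refine (mul_le_mul_of_nonneg_left (norm_sum_le _ _) (hw i)).trans ?_
    rw [Finset.mul_sum]
    refine Finset.sum_le_sum fun j hj => ?_
    have hb : ∀ j, ‖evolve H s (h j)‖ ≤ g := fun j => (norm_evolve_le hH s _).trans (hg j)
    refine (mul_le_mul_of_nonneg_left (norm_nested_commutator_le (hb j) (hb i)) (hw i)).trans ?_
    rw [nf, nf]
    have h1 := mul_le_mul_of_nonneg_right (hwE i j hj)
      (norm_nonneg (A * evolve H s (h j) - evolve H s (h j) * A))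
    nlinarith [mul_le_mul_of_nonneg_left h1 (by positivity : 0 ≤ 2 * g)]
  have hK : ∀ s, ∑ i, ‖f' i s‖ ≤ 2 * g * ((E + 1) * Δ) * ∑ i, ‖f i s‖ := fun s => by
    have hcard : ∀ i, ∑ j ∈ N i, ‖f i s‖ ≤ Δ * ‖f i s‖ := fun i => by
      rw [Finset.sum_const, nsmul_eq_mul]
      exact mul_le_mul_of_nonneg_right (by exact_mod_cast hΔ i) (norm_nonneg _)
    -- Symmetry of the neighbour relation lets the degree bound `Δ` be applied to the inner sum.
    have hswap : ∑ i, ∑ j ∈ N i, ‖f j s‖ = ∑ j, ∑ i ∈ N j, ‖f j s‖ :=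
      Finset.sum_comm' fun i j => by
        simp only [Finset.mem_univ, true_and, and_true]
        exact ⟨hsymm i j, hsymm j i⟩
    calc ∑ i, ‖f' i s‖ ≤ ∑ i, ∑ j ∈ N i, 2 * g * (E * ‖f j s‖ + ‖f i s‖) :=
          Finset.sum_le_sum fun i _ => hD i s
      _ = 2 * g * (E * (∑ i, ∑ j ∈ N i, ‖f j s‖) + ∑ i, ∑ j ∈ N i, ‖f i s‖) := by
          simp only [← Finset.mul_sum, Finset.sum_add_distrib]
      _ ≤ 2 * g * (E * (∑ i, Δ * ‖f i s‖) + ∑ i, Δ * ‖f i s‖) := by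
          rw [hswap]
          gcongr with i _ i _
          · exact hcard i
          · exact hcard i
      _ = _ := by rw [← Finset.mul_sum]; ring
  have := sum_norm_le_of_sum_norm_deriv_le hf hK ht
  simpa only [nf, evolve_zero_time] using this

/-- Negative times are positive times for the Hamiltonian with all terms negated, which satisfies
the same hypotheses. -/
theorem lieb_robinson {ι : Type*} [Fintype ι] [DecidableEq ι] {h : ι → Matrix n n ℂ}
    {g E : ℝ} {Δ : ℕ} {N : ι → Finset ι} {w : ι → ℝ} (hh : ∀ i, (h i).IsHermitian)
    (hg : ∀ i, ‖h i‖ ≤ g) (hN : ∀ i j, j ∉ N i → Commute (h j) (h i))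
    (hsymm : ∀ i j, j ∈ N i → i ∈ N j) (hΔ : ∀ i, (N i).card ≤ Δ) (hg0 : 0 ≤ g) (hE : 0 ≤ E)
    (hw : ∀ i, 0 ≤ w i) (hwE : ∀ i, ∀ j ∈ N i, w i ≤ E * w j) (A : Matrix n n ℂ) (t : ℝ) :
    ∑ i, w i * ‖A * evolve (∑ i, h i) t (h i) - evolve (∑ i, h i) t (h i) * A‖ ≤
      (∑ i, w i * ‖A * h i - h i * A‖) * Real.exp (2 * g * ((E + 1) * Δ) * |t|) := by
  rcases le_total 0 t with ht | ht
  · rw [abs_of_nonneg ht]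
    exact lieb_robinson_of_nonneg hh hg hN hsymm hΔ hg0 hE hw hwE A ht
  · rw [abs_of_nonpos ht]
    have := lieb_robinson_of_nonneg (h := fun i => -h i) (fun i => (hh i).neg)
      (fun i => by rw [norm_neg]; exact hg i) (fun i j hj => (hN i j hj).neg_left.neg_right)
      hsymm hΔ hg0 hE hw hwE A (neg_nonneg.2 ht)
    have e : ∀ i, evolve (∑ i, -h i) (-t) (-h i) = -evolve (∑ i, h i) t (h i) := fun i => by
      rw [Finset.sum_neg_distrib, evolve_neg_left, neg_neg, ← neg_one_smul ℂ, evolve_smul,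
        neg_one_smul]
    have e' : ∀ B : Matrix n n ℂ, ‖A * -B - -B * A‖ = ‖A * B - B * A‖ := fun B => by
      rw [mul_neg, neg_mul, ← neg_sub', norm_neg]
    simp only [e, e'] at this
    exact this

/-- Duhamel's formula as a norm estimate. -/
theorem norm_evolve_sub_evolve_le {H H' A : Matrix n n ℂ} (hH' : H'.IsHermitian)
    {c : ℝ} {t : ℝ}
    (hc : ∀ s, |s| ≤ |t| → ‖(H - H') * evolve H s A - evolve H s A * (H - H')‖ ≤ c) :
    ‖evolve H t A - evolve H' t A‖ ≤ c * |t| := by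
  -- Interaction picture: the derivative of this curve contains only the commutator with `H - H'`,
  -- and the outer evolution does not increase norms.
  let φ : ℝ → Matrix n n ℂ := fun s => evolve H' (-s) (evolve H s A)
  let φ' : ℝ → Matrix n n ℂ := fun s =>
    Complex.I • evolve H' (-s) ((H - H') * evolve H s A - evolve H s A * (H - H'))
  have hφ : ∀ s, HasDerivAt φ (φ' s) s := fun s => by
    have h1 := hasDerivAt_propagator H' s
    have h2 : HasDerivAt (fun s => propagator H' (-s))
        (-(propagator H' (-s) * (Complex.I • H'))) s := by
      have h := (hasDerivAt_propagator H' (-s)).scomp s (hasDerivAt_neg s)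
      rw [neg_one_smul] at h
      exact h
    have h3 := (h2.mul (hasDerivAt_evolve H A s)).mul h1
    have e : φ = fun s => propagator H' (-s) * evolve H s A * propagator H' s :=
      funext fun s => by simp only [φ, evolve_eq H' _ (-s), neg_neg]
    rw [e]
    refine HasDerivAt.congr_deriv h3 ?_
    have hc : evolve H s (H * A - A * H) = H * evolve H s A - evolve H s A * H := by
      have : evolve H s H = H := by
        rw [evolve_eq, (propagator_commute H s).eq, mul_assoc, propagator_mul_neg, mul_one]
      rw [evolve_sub, evolve_mul, evolve_mul, this]
    have hc2 := (propagator_commute H' s).eq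
    simp only [φ', evolve_eq H' _ (-s), neg_neg, hc, Matrix.mul_smul, hc2]
    simp only [← smul_add, ← smul_neg, Matrix.smul_mul, ← mul_assoc]
    congr 1
    simp only [Pi.mul_apply]
    noncomm_ring
  have hb : ∀ s ∈ Set.uIcc 0 t, ‖φ' s‖ ≤ c := fun s hs => by
    simp only [φ']
    rw [norm_smul, Complex.norm_I, one_mul]
    refine (norm_evolve_le hH' _ _).trans (hc s ?_)
    simpa using Set.abs_sub_left_of_mem_uIcc hs
  have := (convex_uIcc (0 : ℝ) t).norm_image_sub_le_of_norm_hasDerivWithin_le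
    (fun s _ => (hφ s).hasDerivWithinAt) hb Set.left_mem_uIcc Set.right_mem_uIcc
  have e : evolve H t A - evolve H' t A = evolve H' t (φ t - φ 0) := by
    simp [φ, evolve_sub, evolve_evolve, evolve_zero_time]
  rw [e]
  refine (norm_evolve_le hH' _ _).trans (this.trans_eq ?_)
  rw [sub_zero, Real.norm_eq_abs]

end LiebRobinson

/-! ### The star algebra of operators supported on a region. -/

/-- Finite-dimensional subspaces are stable under integration. -/
theorem integral_mem_submodule {α E : Type*} [MeasurableSpace α] {μ : Measure α}
    [NormedAddCommGroup E] [NormedSpace ℂ E] [FiniteDimensional ℂ E] (V : Submodule ℂ E)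
    {f : α → E} (hf : ∀ x, f x ∈ V) : ∫ x, f x ∂μ ∈ V := by
  have : CompleteSpace V := FiniteDimensional.complete ℂ V
  have h := V.subtypeₗᵢ.integral_comp_comm (μ := μ) fun x => (⟨f x, hf x⟩ : V)
  simp only [Submodule.coe_subtypeₗᵢ, Submodule.subtype_apply] at h
  rw [h]
  exact Submodule.coe_mem _

section Local

variable {r : ℕ} {Λ : Finset (Fin r → ℤ)}

/-- An operator acts on `S` iff its matrix elements vanish unless the configurations agree off `S`,
and then depend only on the restrictions to `S`. -/
theorem actsOn_iff {M : Op Λ} {S : Set Λ} : ActsOn M S ↔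
    (∀ σ τ : Config Λ, (∃ x, x ∉ S ∧ σ x ≠ τ x) → M σ τ = 0) ∧
    ∀ σ τ σ' τ' : Config Λ, (∀ x, x ∉ S → σ x = τ x) → (∀ x, x ∉ S → σ' x = τ' x) →
      (∀ x ∈ S, σ x = σ' x) → (∀ x ∈ S, τ x = τ' x) → M σ τ = M σ' τ' := by
  classical
  constructor
  · rintro ⟨N, hN⟩
    refine ⟨fun σ τ h => (hN σ τ).2 h, fun σ τ σ' τ' h h' hσ hτ => ?_⟩
    rw [(hN σ τ).1 h, (hN σ' τ').1 h']
    congr 1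
    · exact funext fun x => hσ x x.2
    · exact funext fun x => hτ x x.2
  · rintro ⟨h0, h1⟩
    let ext : (S → Fin 2) → Config Λ := fun a x => if h : x ∈ S then a ⟨x, h⟩ else 0
    refine ⟨fun a b => M (ext a) (ext b), fun σ τ => ⟨fun h => ?_, h0 σ τ⟩⟩
    refine h1 _ _ _ _ h (fun x hx => ?_) (fun x hx => ?_) (fun x hx => ?_) <;> simp [ext, hx]

theorem ActsOn.mono {M : Op Λ} {S T : Set Λ} (hM : ActsOn M S) (hST : S ⊆ T) : ActsOn M T := by
  rw [actsOn_iff] at hM ⊢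
  refine ⟨fun σ τ ⟨x, hx, h⟩ => hM.1 σ τ ⟨x, fun h' => hx (hST h'), h⟩,
    fun σ τ σ' τ' h h' hσ hτ => ?_⟩
  by_cases hs : ∀ x, x ∉ S → σ x = τ x
  · refine hM.2 _ _ _ _ hs (fun x hx => ?_) (fun x hx => hσ x (hST hx)) fun x hx => hτ x (hST hx)
    by_cases hxT : x ∈ T
    · rw [← hσ x hxT, ← hτ x hxT, hs x hx]
    · exact h' x hxT
  · push Not at hs
    obtain ⟨x, hx, hne⟩ := hs
    rw [hM.1 σ τ ⟨x, hx, hne⟩, hM.1 σ' τ' ⟨x, hx, ?_⟩]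
    have hxT : x ∈ T := by
      by_contra hxT
      exact hne (h x hxT)
    rwa [← hσ x hxT, ← hτ x hxT]

theorem ActsOn.mul {M M' : Op Λ} {S : Set Λ} (hM : ActsOn M S) (hM' : ActsOn M' S) :
    ActsOn (M * M') S := by
  classical
  rw [actsOn_iff] at hM hM' ⊢
  constructor
  · rintro σ τ ⟨x, hx, hne⟩
    rw [Matrix.mul_apply]
    refine Finset.sum_eq_zero fun ρ _ => ?_
    by_cases h : σ x = ρ x
    · rw [hM'.1 ρ τ ⟨x, hx, h ▸ hne⟩, mul_zero]
    · rw [hM.1 σ ρ ⟨x, hx, h⟩, zero_mul]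
  · intro σ τ σ' τ' h h' hσ hτ
    -- Off `S` only the intermediate configuration agreeing with `σ` contributes. Swapping `σ x` and
    -- `σ' x` off `S` reindexes the sum so that it corresponds to the one agreeing with `σ'`.
    let φ : Config Λ ≃ Config Λ := Equiv.piCongrRight fun x =>
      if x ∈ S then Equiv.refl _ else Equiv.swap (σ x) (σ' x)
    have φin : ∀ ρ x, x ∈ S → φ ρ x = ρ x := fun ρ x hx => by simp [φ, hx]
    have φout : ∀ ρ x, x ∉ S → (φ ρ x = σ' x ↔ ρ x = σ x) := fun ρ x hx => by
      have e : φ ρ x = Equiv.swap (σ x) (σ' x) (ρ x) := by simp [φ, hx]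
      rw [e, Equiv.swap_apply_eq_iff, Equiv.swap_apply_right]
    rw [Matrix.mul_apply, Matrix.mul_apply,
      ← Equiv.sum_comp φ fun ρ => M σ' ρ * M' ρ τ']
    refine Finset.sum_congr rfl fun ρ _ => ?_
    by_cases hρ : ∀ x, x ∉ S → ρ x = σ x
    · congr 1
      · refine hM.2 _ _ _ _ (fun x hx => (hρ x hx).symm)
          (fun x hx => ((φout ρ x hx).2 (hρ x hx)).symm) hσ fun x hx => (φin ρ x hx).symm
      · refine hM'.2 _ _ _ _ (fun x hx => (hρ x hx).trans (h x hx))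
          (fun x hx => ((φout ρ x hx).2 (hρ x hx)).trans (h' x hx))
          (fun x hx => (φin ρ x hx).symm) hτ
    · push Not at hρ
      obtain ⟨x, hx, hne⟩ := hρ
      rw [hM.1 σ ρ ⟨x, hx, hne.symm⟩,
        hM.1 σ' (φ ρ) ⟨x, hx, fun e => hne ((φout ρ x hx).1 e.symm)⟩, zero_mul, zero_mul]

/-- The operators acting on `S` form a star subalgebra. -/
def localOps (S : Set Λ) : StarSubalgebra ℂ (Op Λ) where
  carrier := {M | ActsOn M S}
  mul_mem' hM hM' := hM.mul hM'
  add_mem' {M M'} hM hM' := by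
    rw [Set.mem_ofPred_eq, actsOn_iff] at *
    refine ⟨fun σ τ h => by simp [hM.1 σ τ h, hM'.1 σ τ h], fun σ τ σ' τ' h h' hσ hτ => ?_⟩
    simp [hM.2 σ τ σ' τ' h h' hσ hτ, hM'.2 σ τ σ' τ' h h' hσ hτ]
  algebraMap_mem' c := by
    rw [Set.mem_ofPred_eq, actsOn_iff]
    refine ⟨fun σ τ ⟨x, _, h⟩ => ?_, fun σ τ σ' τ' h h' hσ hτ => ?_⟩
    · have : σ ≠ τ := fun e => h (by rw [e])
      simp [Matrix.algebraMap_matrix_apply, this]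
    · have : σ = τ ↔ σ' = τ' := by
        constructor <;> intro e <;> ext1 x <;> by_cases hx : x ∈ S
        · rw [← hσ x hx, ← hτ x hx, e]
        · exact h' x hx
        · rw [hσ x hx, hτ x hx, e]
        · exact h x hx
      simp [Matrix.algebraMap_matrix_apply, this]
  star_mem' {M} hM := by
    rw [Set.mem_ofPred_eq, actsOn_iff] at *
    refine ⟨fun σ τ ⟨x, hx, h⟩ => ?_, fun σ τ σ' τ' h h' hσ hτ => ?_⟩
    · rw [Matrix.star_apply, hM.1 τ σ ⟨x, hx, h.symm⟩, star_zero]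
    · rw [Matrix.star_apply, Matrix.star_apply,
        hM.2 τ σ τ' σ' (fun x hx => (h x hx).symm) (fun x hx => (h' x hx).symm) hτ hσ]

theorem mem_localOps {M : Op Λ} {S : Set Λ} : M ∈ localOps S ↔ ActsOn M S := Iff.rfl

/-- In either product a single intermediate configuration survives: the one already updated on the
support of the left factor. Both entries are then the same product of two numbers. -/
theorem commute_of_disjoint {M M' : Op Λ} {S T : Set Λ} (hM : ActsOn M S) (hM' : ActsOn M' T)
    (hST : Disjoint S T) : Commute M M' := by
  classical
  have key : ∀ {M M' : Op Λ} {S T : Set Λ}, ActsOn M S → ActsOn M' T → Disjoint S T →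
      ∀ σ τ : Config Λ, (M * M') σ τ =
        M σ (fun x => if x ∈ S then τ x else σ x) * M' (fun x => if x ∈ S then τ x else σ x) τ := by
    intro M M' S T hM hM' hST σ τ
    rw [actsOn_iff] at hM hM'
    rw [Matrix.mul_apply]
    refine Finset.sum_eq_single _ (fun ρ _ hρ => ?_) fun h => absurd (Finset.mem_univ _) h
    obtain ⟨x, hx⟩ := Function.ne_iff.1 hρ
    by_cases hS : x ∈ S
    · rw [if_pos hS] at hx
      rw [hM'.1 ρ τ ⟨x, Set.disjoint_left.1 hST hS, hx⟩, mul_zero]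
    · rw [if_neg hS] at hx
      rw [hM.1 σ ρ ⟨x, hS, hx.symm⟩, zero_mul]
  ext σ τ
  rw [key hM hM' hST, key hM' hM hST.symm]
  rw [actsOn_iff] at hM hM'
  have hd : ∀ x, x ∈ S → x ∉ T := fun x h => Set.disjoint_left.1 hST h
  have hd' : ∀ x, x ∈ T → x ∉ S := fun x h => Set.disjoint_right.1 hST h
  by_cases hne : ∃ x, (x ∉ S ∧ x ∉ T) ∧ σ x ≠ τ x
  · obtain ⟨x, ⟨hS, hT⟩, hx⟩ := hne
    rw [hM'.1 _ τ ⟨x, hT, by simpa [hS] using hx⟩, hM.1 _ τ ⟨x, hS, by simpa [hT] using hx⟩]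
    simp
  · push Not at hne
    rw [mul_comm]
    congr 1
    · refine hM'.2 _ _ _ _ (fun x hx => ?_) (fun x hx => ?_) (fun x hx => ?_) fun x hx => ?_
      · by_cases hS : x ∈ S
        · simp [hS]
        · simp [hS, hne x ⟨hS, hx⟩]
      · simp [hx]
      · simp [hd' x hx]
      · simp [hx]
    · refine hM.2 _ _ _ _ (fun x hx => ?_) (fun x hx => ?_) (fun x hx => ?_) fun x hx => ?_
      · simp [hx]
      · by_cases hT : x ∈ T
        · simp [hT]
        · simp [hT, hne x ⟨hx, hT⟩]
      · simp [hd x hx]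
      · simp [hx]

/-- Closedness is automatic in finite dimension. It is what keeps exponentials and functional
calculus of local operators local. -/
theorem isClosed_localOps (S : Set Λ) : IsClosed (localOps S : Set (Op Λ)) :=
  (Subalgebra.toSubmodule (localOps S).toSubalgebra).closed_of_finiteDimensional

theorem exp_mem_localOps {S : Set Λ} {M : Op Λ} (hM : M ∈ localOps S) :
    NormedSpace.exp M ∈ localOps S := by
  have h := NormedSpace.exp_series_hasSum_exp' (𝕂 := ℂ) M
  refine (isClosed_localOps S).mem_of_tendsto h (Filter.Eventually.of_forall fun s => ?_)
  exact sum_mem fun i _ => SMulMemClass.smul_mem _ (pow_mem hM i)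

theorem evolve_mem_localOps {S : Set Λ} {H A : Op Λ} (hH : H ∈ localOps S) (hA : A ∈ localOps S)
    (t : ℝ) : evolve H t A ∈ localOps S :=
  mul_mem (mul_mem (exp_mem_localOps (SMulMemClass.smul_mem _ hH)) hA)
    (exp_mem_localOps (SMulMemClass.smul_mem _ hH))

theorem integral_mem_localOps {S : Set Λ} {α : Type*} [MeasurableSpace α] {μ : Measure α}
    {f : α → Op Λ} (hf : ∀ x, f x ∈ localOps S) : ∫ x, f x ∂μ ∈ localOps S :=
  integral_mem_submodule (Subalgebra.toSubmodule (localOps S).toSubalgebra) hf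

theorem jumpFourier_mem_localOps {S : Set Λ} {H A : Op Λ} (hH : H ∈ localOps S)
    (hA : A ∈ localOps S) (β ω : ℝ) : jumpFourier H β ω A ∈ localOps S :=
  SMulMemClass.smul_mem _ (integral_mem_localOps fun t =>
    SMulMemClass.smul_mem _ (evolve_mem_localOps hH hA t))

theorem coherentTerm_mem_localOps {S : Set Λ} {H A : Op Λ} (hH : H ∈ localOps S)
    (hA : A ∈ localOps S) (β : ℝ) : coherentTerm H β A ∈ localOps S :=
  integral_mem_localOps fun _ => SMulMemClass.smul_mem _ (evolve_mem_localOps hH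
    (integral_mem_localOps fun _ => SMulMemClass.smul_mem _
      (mul_mem (evolve_mem_localOps hH (star_mem hA) _) (evolve_mem_localOps hH hA _))) _)

end Local

/-! ### Lattice geometry and truncated Hamiltonians. -/

section Lattice

variable {r : ℕ} {Λ : Finset (Fin r → ℤ)}

/-- A lattice site as a point of Euclidean space. -/
def toEuclidean (x : Fin r → ℤ) : EuclideanSpace ℝ (Fin r) := WithLp.toLp 2 fun i => (x i : ℝ)

theorem latDist_eq_dist (x y : Fin r → ℤ) : latDist x y = dist (toEuclidean x) (toEuclidean y) := by
  rw [EuclideanSpace.dist_eq]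
  simp [latDist, toEuclidean, Real.dist_eq, sq_abs]

theorem latDist_self (x : Fin r → ℤ) : latDist x x = 0 := by rw [latDist_eq_dist, dist_self]

theorem latDist_comm (x y : Fin r → ℤ) : latDist x y = latDist y x := by
  rw [latDist_eq_dist, latDist_eq_dist, dist_comm]

theorem latDist_triangle (x y z : Fin r → ℤ) : latDist x z ≤ latDist x y + latDist y z := by
  simp only [latDist_eq_dist]
  exact dist_triangle _ _ _

theorem abs_sub_le_latDist (x y : Fin r → ℤ) (i : Fin r) :
    |(x i : ℝ) - y i| ≤ latDist x y := by
  rw [← Real.sqrt_sq_eq_abs]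
  exact Real.sqrt_le_sqrt
    (Finset.single_le_sum (f := fun i => ((x i : ℝ) - y i) ^ 2) (fun i _ => sq_nonneg _)
      (Finset.mem_univ i))

theorem subset_nbhd {R : ℝ} (hR : 0 ≤ R) (X : Finset Λ) : (X : Set Λ) ⊆ nbhd R X :=
  fun x hx => ⟨x, hx, by rwa [latDist_self]⟩

/-- The sites of `Λ` at distance at most `m` from `x`. -/
def latBall (x : Λ) (m : ℕ) : Finset Λ :=
  Finset.univ.filter fun y => latDist (x : Fin r → ℤ) (y : Fin r → ℤ) ≤ m

theorem mem_latBall {x y : Λ} {m : ℕ} :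
    y ∈ latBall x m ↔ latDist (x : Fin r → ℤ) (y : Fin r → ℤ) ≤ m := by
  simp [latBall]

theorem card_latBall_le (x : Λ) (m : ℕ) : (latBall x m).card ≤ (2 * m + 1) ^ r := by
  classical
  have h : (latBall x m).card ≤ (Fintype.piFinset fun i : Fin r =>
      Finset.Icc ((x : Fin r → ℤ) i - m) ((x : Fin r → ℤ) i + m)).card := by
    rw [← Finset.card_map (Function.Embedding.subtype (· ∈ Λ))]
    refine Finset.card_le_card fun u hu => ?_
    obtain ⟨y, hy, rfl⟩ := Finset.mem_map.1 hu
    refine Fintype.mem_piFinset.2 fun i => ?_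
    rw [Function.Embedding.subtype_apply]
    have h1 := (abs_sub_le_latDist (x : Fin r → ℤ) (y : Fin r → ℤ) i).trans (mem_latBall.1 hy)
    have h2 : |(x : Fin r → ℤ) i - (y : Fin r → ℤ) i| ≤ m := by exact_mod_cast h1
    rw [abs_le] at h2
    rw [Finset.mem_Icc]
    constructor <;> linarith [h2.1, h2.2]
  refine h.trans_eq ?_
  rw [Fintype.card_piFinset]
  have : ∀ i : Fin r,
      (Finset.Icc ((x : Fin r → ℤ) i - m) ((x : Fin r → ℤ) i + m)).card = 2 * m + 1 := fun i => by
    rw [Int.card_Icc]; omega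
  simp [this]

theorem card_powerset_latBall_le (x : Λ) (m : ℕ) :
    (latBall x m).powerset.card ≤ 2 ^ (2 * m + 1) ^ r := by
  rw [Finset.card_powerset]
  exact Nat.pow_le_pow_right two_pos (card_latBall_le x m)

/-- The exponential of `D` is the Lieb–Robinson weight. `D` is the distance to `X`, except that for
empty `X`, where the neighbourhood is empty too, the constant `R` serves. -/
theorem exists_dist_function (X : Finset Λ) (R : ℝ) : ∃ D : Λ → ℝ,
    (∀ x y : Λ, D x ≤ D y + latDist (x : Fin r → ℤ) (y : Fin r → ℤ)) ∧ (∀ x ∈ X, D x ≤ 0) ∧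
      ∀ y, y ∉ nbhd R X → R ≤ D y := by
  rcases X.eq_empty_or_nonempty with rfl | hX
  · refine ⟨fun _ => R, fun x y => ?_, by simp, fun _ _ => le_rfl⟩
    exact le_add_of_nonneg_right (Real.sqrt_nonneg _)
  · let p : Λ → EuclideanSpace ℝ (Fin r) := fun x => toEuclidean x
    refine ⟨fun y => Metric.infDist (p y) (p '' X), fun x y => ?_, fun x hx => ?_, fun y hy => ?_⟩
    · rw [latDist_eq_dist]
      exact Metric.infDist_le_infDist_add_dist
    · exact (Metric.infDist_zero_of_mem (Set.mem_image_of_mem p hx)).le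
    · rw [Metric.le_infDist ((Finset.coe_nonempty.2 hX).image p)]
      rintro _ ⟨x, hx, rfl⟩
      by_contra hlt
      refine hy ⟨x, hx, ?_⟩
      rw [latDist_comm, latDist_eq_dist]
      exact (not_le.1 hlt).le

open Classical in
/-- The part of the Hamiltonian `∑ Z, h Z` supported inside `S`. -/
def truncHam (h : Finset Λ → Op Λ) (S : Set Λ) : Op Λ :=
  ∑ Z ∈ Finset.univ.filter fun Z : Finset Λ => (Z : Set Λ) ⊆ S, h Z

theorem truncHam_mem_localOps {k : ℕ} {g : ℝ} {h : Finset Λ → Op Λ} (hh : IsLocalInteraction k g h)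
    (S : Set Λ) : truncHam h S ∈ localOps S := by
  unfold truncHam
  exact sum_mem fun Z hZ => (hh.actsOn Z).mono (by simpa using hZ)

theorem truncHam_isHermitian {k : ℕ} {g : ℝ} {h : Finset Λ → Op Λ}
    (hh : IsLocalInteraction k g h) (S : Set Λ) : (truncHam h S).IsHermitian :=
  isHermitian_sum _ hh.isHermitian

end Lattice

/-! ### Quasi-locality of Heisenberg evolution. -/

/-- Quasi-locality of the Heisenberg evolution: it is well approximated by the evolution under the
part of the Hamiltonian near the support of the observable. -/
theorem exists_norm_evolve_sub_evolve_truncHam_le (r k : ℕ) {g : ℝ} (hg : 0 ≤ g) :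
    ∃ c v : ℝ, 0 ≤ c ∧ 0 ≤ v ∧ ∀ (Λ : Finset (Fin r → ℤ)) (h : Finset Λ → Op Λ) (X : Finset Λ)
      (A : Op Λ) (R : ℝ), IsLocalInteraction k g h → X.card ≤ k → ActsOn A (X : Set Λ) →
      ‖A‖ ≤ g → ∀ t : ℝ, ‖evolve (∑ Z, h Z) t A - evolve (truncHam h (nbhd R X)) t A‖ ≤
        c * Real.exp (v * |t| - R) := by
  classical
  -- A set of diameter at most `k` meeting another such set through `z` lies in the ball of radius
  -- `2k` about `z`, so `Δ` counts the subsets of that ball. `C₀` similarly counts sets meeting `X`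
  -- by subsets of balls of radius `k`.
  let Δ : ℕ := 2 ^ (2 * (2 * k) + 1) ^ r
  let C₀ : ℝ := (k * 2 ^ (2 * k + 1) ^ r : ℕ) * (Real.exp k * (2 * g * g))
  let v : ℝ := 2 * g * ((Real.exp (2 * k) + 1) * Δ)
  have hv : 0 ≤ v := by positivity
  have hC₀ : 0 ≤ C₀ := by positivity
  refine ⟨Real.exp k * C₀, v + 1, by positivity, by positivity, ?_⟩
  intro Λ h X A R hh hX hA hAg t
  obtain ⟨D, hD, hDX, hDR⟩ := exists_dist_function X R
  -- The weight is read off at an arbitrary point of `Z`. For an active term another point changes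
  -- it by at most `exp k` either way, so overlapping active terms have weights comparable up to
  -- `exp (2k)`.
  let w : Finset Λ → ℝ := fun Z => if hZ : Z.Nonempty then Real.exp (D hZ.choose) else 0
  let N : Finset Λ → Finset (Finset Λ) := fun Z =>
    Finset.univ.filter fun W => h W ≠ 0 ∧ h Z ≠ 0 ∧ ¬Disjoint Z W
  have hw0 : ∀ Z, 0 ≤ w Z := fun Z => by
    simp only [w]; split_ifs
    · positivity
    · exact le_rfl
  have hw_le : ∀ Z z, h Z ≠ 0 → z ∈ Z → w Z ≤ Real.exp (D z + k) := fun Z z hZ hz => by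
    have hne : Z.Nonempty := ⟨z, hz⟩
    simp only [w, hne, dif_pos, Real.exp_le_exp]
    exact (hD _ z).trans (add_le_add_right (hh.diam_le Z hZ _ hne.choose_spec z hz) _)
  have hle_w : ∀ Z z, h Z ≠ 0 → z ∈ Z → Real.exp (D z - k) ≤ w Z := fun Z z hZ hz => by
    have hne : Z.Nonempty := ⟨z, hz⟩
    simp only [w, hne, dif_pos, Real.exp_le_exp]
    have := hD z hne.choose
    have := hh.diam_le Z hZ z hz _ hne.choose_spec
    linarith
  have hLR := lieb_robinson (h := h) (g := g) (E := Real.exp (2 * k)) (Δ := Δ) (N := N) (w := w)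
    hh.isHermitian hh.norm_le
    (fun Z W hW => by
      by_cases hZ0 : h Z = 0
      · rw [hZ0]; exact Commute.zero_right _
      by_cases hW0 : h W = 0
      · rw [hW0]; exact Commute.zero_left _
      have : Disjoint Z W := by
        by_contra hd
        exact hW (Finset.mem_filter.2 ⟨Finset.mem_univ _, hW0, hZ0, hd⟩)
      exact (commute_of_disjoint (hh.actsOn Z) (hh.actsOn W)
        (Finset.disjoint_coe.2 this)).symm)
    (fun Z W hW => by
      simp only [N, Finset.mem_filter, Finset.mem_univ, true_and] at hW ⊢
      exact ⟨hW.2.1, hW.1, fun hd => hW.2.2 hd.symm⟩)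
    (fun Z => by
      rcases Z.eq_empty_or_nonempty with rfl | ⟨z, hz⟩
      · simp [N]
      refine (Finset.card_le_card fun W hW => ?_).trans (card_powerset_latBall_le z (2 * k))
      simp only [N, Finset.mem_filter, Finset.mem_univ, true_and] at hW
      obtain ⟨hW0, hZ0, hd⟩ := hW
      obtain ⟨y, hyZ, hyW⟩ := Finset.not_disjoint_iff.1 hd
      rw [Finset.mem_powerset]
      intro u hu
      rw [mem_latBall]
      refine (latDist_triangle _ (y : Fin r → ℤ) _).trans ?_
      have h1 := hh.diam_le Z hZ0 z hz y hyZ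
      have h2 := hh.diam_le W hW0 y hyW u hu
      push_cast
      linarith)
    hg (Real.exp_nonneg _) hw0
    (fun Z W hW => by
      simp only [N, Finset.mem_filter, Finset.mem_univ, true_and] at hW
      obtain ⟨hW0, hZ0, hd⟩ := hW
      obtain ⟨y, hyZ, hyW⟩ := Finset.not_disjoint_iff.1 hd
      refine (hw_le Z y hZ0 hyZ).trans ?_
      calc Real.exp (D y + k) = Real.exp (2 * k) * Real.exp (D y - k) := by
            rw [← Real.exp_add]; ring_nf
        _ ≤ _ := mul_le_mul_of_nonneg_left (hle_w W y hW0 hyW) (Real.exp_nonneg _)) A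
  have hinit : ∑ Z, w Z * ‖A * h Z - h Z * A‖ ≤ C₀ := by
    let T : Finset (Finset Λ) := X.biUnion fun x => (latBall x k).powerset
    have hT : T.card ≤ k * 2 ^ (2 * k + 1) ^ r :=
      Finset.card_biUnion_le.trans ((Finset.sum_le_card_nsmul _ _ _ fun x _ =>
        card_powerset_latBall_le x k).trans (by
          rw [smul_eq_mul]; exact Nat.mul_le_mul_right _ hX))
    have hvan : ∀ Z, Z ∉ T → w Z * ‖A * h Z - h Z * A‖ = 0 := fun Z hZT => by
      have hc : Commute A (h Z) := by
        by_cases hZ0 : h Z = 0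
        · rw [hZ0]; exact Commute.zero_right _
        refine commute_of_disjoint hA (hh.actsOn Z) (Finset.disjoint_coe.2 ?_)
        refine Finset.disjoint_left.2 fun x hxX hxZ => hZT ?_
        refine Finset.mem_biUnion.2 ⟨x, hxX, Finset.mem_powerset.2 fun u hu => ?_⟩
        exact mem_latBall.2 (hh.diam_le Z hZ0 x hxZ u hu)
      rw [hc.eq, sub_self, norm_zero, mul_zero]
    have hbd : ∀ Z, w Z * ‖A * h Z - h Z * A‖ ≤ Real.exp k * (2 * g * g) := fun Z => by
      by_cases hd : h Z = 0 ∨ Disjoint X Z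
      · have hc : Commute A (h Z) := by
          rcases hd with hZ0 | hd
          · rw [hZ0]; exact Commute.zero_right _
          · exact commute_of_disjoint hA (hh.actsOn Z) (Finset.disjoint_coe.2 hd)
        rw [hc.eq, sub_self, norm_zero, mul_zero]
        positivity
      · push Not at hd
        obtain ⟨x, hxX, hxZ⟩ := Finset.not_disjoint_iff.1 hd.2
        gcongr
        · refine (hw_le Z x hd.1 hxZ).trans (Real.exp_le_exp.2 ?_)
          linarith [hDX x hxX]
        · refine (norm_commutator_le _ _).trans ?_
          have := hh.norm_le Z
          gcongr
    calc ∑ Z, w Z * ‖A * h Z - h Z * A‖ = ∑ Z ∈ T, w Z * ‖A * h Z - h Z * A‖ :=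
          (Finset.sum_subset (Finset.subset_univ _) fun Z _ hZ => hvan Z hZ).symm
      _ ≤ T.card • (Real.exp k * (2 * g * g)) := Finset.sum_le_card_nsmul _ _ _ fun Z _ => hbd Z
      _ ≤ C₀ := by
          rw [nsmul_eq_mul]
          exact mul_le_mul_of_nonneg_right (by exact_mod_cast hT) (by positivity)
  have hHerm : (∑ Z, h Z).IsHermitian := isHermitian_sum _ hh.isHermitian
  have hcomm : ∀ s, |s| ≤ |t| →
      ‖(∑ Z, h Z - truncHam h (nbhd R X)) * evolve (∑ Z, h Z) s A -
        evolve (∑ Z, h Z) s A * (∑ Z, h Z - truncHam h (nbhd R X))‖ ≤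
        Real.exp (k - R) * (C₀ * Real.exp (v * |t|)) := fun s hs => by
    have e : ∑ Z, h Z - truncHam h (nbhd R X) =
        ∑ Z ∈ Finset.univ.filter fun Z : Finset Λ => ¬(Z : Set Λ) ⊆ nbhd R X, h Z := by
      rw [truncHam, ← Finset.sum_filter_add_sum_filter_not Finset.univ
        (fun Z : Finset Λ => (Z : Set Λ) ⊆ nbhd R X), add_sub_cancel_left]
    rw [e, Finset.sum_mul, Finset.mul_sum, ← Finset.sum_sub_distrib]
    set H := ∑ Z, h Z
    calc _ ≤ ∑ Z ∈ Finset.univ.filter fun Z : Finset Λ => ¬(Z : Set Λ) ⊆ nbhd R X,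
          ‖h Z * evolve H s A - evolve H s A * h Z‖ := norm_sum_le _ _
      _ ≤ ∑ Z ∈ Finset.univ.filter fun Z : Finset Λ => ¬(Z : Set Λ) ⊆ nbhd R X,
          Real.exp (k - R) * (w Z * ‖A * evolve H (-s) (h Z) - evolve H (-s) (h Z) * A‖) := by
          refine Finset.sum_le_sum fun Z hZ => ?_
          by_cases hZ0 : h Z = 0
          · simp only [hZ0, zero_mul, mul_zero, sub_self, norm_zero]
            exact mul_nonneg (Real.exp_nonneg _) (mul_nonneg (hw0 Z) (norm_nonneg _))
          obtain ⟨y, hyZ, hy⟩ := Set.not_subset.1 (Finset.mem_filter.1 hZ).2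
          -- A discarded active term contains a point where `D` is at least `R`, so inserting its
          -- weight gains the factor `exp (k - R)`.
          have h1 : 1 ≤ Real.exp (k - R) * w Z := by
            calc (1 : ℝ) = Real.exp (k - R) * Real.exp (R - k) := by
                  rw [← Real.exp_add]; simp
              _ ≤ Real.exp (k - R) * w Z := by
                  refine mul_le_mul_of_nonneg_left
                    (le_trans (Real.exp_le_exp.2 ?_) (hle_w Z y hZ0 hyZ)) (Real.exp_nonneg _)
                  linarith [hDR y hy]
          rw [norm_sub_rev, ← mul_assoc]
          refine (norm_commutator_evolve_evolve_le hHerm s A (h Z)).trans ?_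
          exact le_mul_of_one_le_left (norm_nonneg _) h1
      _ = Real.exp (k - R) * ∑ Z ∈ Finset.univ.filter fun Z : Finset Λ => ¬(Z : Set Λ) ⊆ nbhd R X,
          w Z * ‖A * evolve H (-s) (h Z) - evolve H (-s) (h Z) * A‖ := by rw [Finset.mul_sum]
      _ ≤ Real.exp (k - R) * (C₀ * Real.exp (v * |t|)) := by
          refine mul_le_mul_of_nonneg_left ?_ (Real.exp_nonneg _)
          refine (Finset.sum_le_sum_of_subset_of_nonneg (Finset.subset_univ _) fun Z _ _ =>
            mul_nonneg (hw0 Z) (norm_nonneg _)).trans ((hLR (-s)).trans ?_)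
          rw [abs_neg]
          gcongr
  refine (norm_evolve_sub_evolve_le (truncHam_isHermitian hh _) hcomm).trans ?_
  -- The linear factor from Duhamel is absorbed into the exponential, which raises the velocity from
  -- `v` to `v + 1`.
  have h1 : |t| ≤ Real.exp |t| := by linarith [Real.add_one_le_exp |t|]
  calc Real.exp (k - R) * (C₀ * Real.exp (v * |t|)) * |t|
      ≤ Real.exp (k - R) * (C₀ * Real.exp (v * |t|)) * Real.exp |t| := by gcongr
    _ = C₀ * (Real.exp (k - R) * Real.exp (v * |t|) * Real.exp |t|) := by ring
    _ = C₀ * (Real.exp k * Real.exp ((v + 1) * |t| - R)) := by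
        simp only [← Real.exp_add]; ring_nf
    _ = _ := by ring

/-! ### Trace-norm duality and diamond-norm calculus. -/

section TraceNorm

variable {n : Type*} [Fintype n] [DecidableEq n]

open scoped Kronecker

theorem exists_unitary_diagonalization {M : Matrix n n ℂ} (hM : M.IsHermitian) :
    ∃ V : Matrix n n ℂ, Vᴴ * V = 1 ∧ V * Vᴴ = 1 ∧
      M = V * Matrix.diagonal (fun i => (hM.eigenvalues i : ℂ)) * Vᴴ := by
  refine ⟨hM.eigenvectorUnitary, ?_, ?_, ?_⟩
  · exact Unitary.coe_star_mul_self hM.eigenvectorUnitary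
  · exact Unitary.coe_mul_star_self hM.eigenvectorUnitary
  · have h := hM.spectral_theorem
    rw [Unitary.conjStarAlgAut_apply] at h
    exact h

theorem norm_le_one_of_isometry {V : Matrix n n ℂ} (hV : Vᴴ * V = 1) : ‖V‖ ≤ 1 :=
  norm_le_one_of_conjTranspose_mul_self (by rw [hV]; exact norm_one_le)

open scoped ComplexOrder in
theorem eigenvalues_conjTranspose_mul_self_nonneg (X : Matrix n n ℂ) (i : n) :
    0 ≤ (Matrix.isHermitian_conjTranspose_mul_self X).eigenvalues i :=
  (Matrix.posSemidef_conjTranspose_mul_self X).eigenvalues_nonneg i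

/-- In an eigenbasis `V` of `X†X` the columns of `XV` have the singular values as norms, so each
diagonal entry of `V†U(XV)` is at most `‖U‖` times a singular value. -/
theorem norm_trace_mul_le (U X : Matrix n n ℂ) : ‖(U * X).trace‖ ≤ ‖U‖ * traceNorm X := by
  obtain ⟨V, hV, hV', hX⟩ :=
    exists_unitary_diagonalization (Matrix.isHermitian_conjTranspose_mul_self X)
  unfold traceNorm
  set ev := (Matrix.isHermitian_conjTranspose_mul_self X).eigenvalues
  have htr : (U * X).trace = (Vᴴ * U * (X * V)).trace := by
    rw [Matrix.trace_mul_comm (Vᴴ * U)]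
    calc (U * X).trace = (X * (V * Vᴴ) * U).trace := by
          rw [hV', mul_one, Matrix.trace_mul_comm]
      _ = _ := by simp only [mul_assoc]
  have hY : (X * V)ᴴ * (X * V) = Matrix.diagonal fun i => (ev i : ℂ) := by
    rw [Matrix.conjTranspose_mul]
    calc Vᴴ * Xᴴ * (X * V) = Vᴴ * (Xᴴ * X) * V := by simp only [mul_assoc]
      _ = (Vᴴ * V) * (Matrix.diagonal fun i => (ev i : ℂ)) * (Vᴴ * V) := by
          rw [hX]; simp only [mul_assoc]
      _ = _ := by rw [hV, one_mul, mul_one]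
  set Y := X * V
  have hcol : ∀ i, ‖(WithLp.toLp 2 fun j => Y j i : EuclideanSpace ℂ n)‖ = √(ev i) := fun i => by
    rw [EuclideanSpace.norm_eq]
    congr 1
    have h := congrFun (congrFun hY i) i
    rw [Matrix.mul_apply, Matrix.diagonal_apply_eq] at h
    have h' : ((∑ j, ‖Y j i‖ ^ 2 : ℝ) : ℂ) = ev i := by
      rw [← h]
      push_cast
      refine Finset.sum_congr rfl fun j _ => ?_
      rw [Matrix.conjTranspose_apply, Complex.star_def, Complex.conj_mul']
    exact_mod_cast h'
  have hW : ‖Vᴴ * U‖ ≤ ‖U‖ := by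
    refine (norm_mul_le _ _).trans ?_
    rw [Matrix.l2_opNorm_conjTranspose]
    exact mul_le_of_le_one_left (norm_nonneg _) (norm_le_one_of_isometry hV)
  rw [htr, Matrix.trace, Finset.mul_sum]
  refine (norm_sum_le _ _).trans (Finset.sum_le_sum fun i _ => ?_)
  have h1 := Matrix.l2_opNorm_mulVec (Vᴴ * U) (WithLp.toLp 2 fun j => Y j i : EuclideanSpace ℂ n)
  rw [hcol] at h1
  have h2 := PiLp.norm_apply_le ((EuclideanSpace.equiv n ℂ).symm
    ((Vᴴ * U).mulVec (WithLp.toLp 2 fun j => Y j i : EuclideanSpace ℂ n))) i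
  refine (le_trans (le_of_eq ?_) h2).trans (h1.trans ?_)
  · rfl
  · exact mul_le_mul_of_nonneg_right hW (Real.sqrt_nonneg _)

theorem exists_trace_mul_eq_traceNorm (X : Matrix n n ℂ) :
    ∃ U : Matrix n n ℂ, ‖U‖ ≤ 1 ∧ (U * X).trace = (traceNorm X : ℂ) := by
  obtain ⟨V, hV, hV', hX⟩ :=
    exists_unitary_diagonalization (Matrix.isHermitian_conjTranspose_mul_self X)
  have hpos := eigenvalues_conjTranspose_mul_self_nonneg X
  unfold traceNorm
  set ev := (Matrix.isHermitian_conjTranspose_mul_self X).eigenvalues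
  -- The convention `0⁻¹ = 0` makes this a pseudo-inverse of `|X|`, so `U` is the adjoint of the
  -- polar partial isometry even for singular `X`.
  let P : Matrix n n ℂ := Matrix.diagonal fun i => ((√(ev i) : ℝ) : ℂ)⁻¹
  have hP : Pᴴ = P := by
    rw [Matrix.diagonal_conjTranspose]
    congr 1
    ext i
    simp
  have hsq : ∀ i, ((√(ev i) : ℝ) : ℂ) * ((√(ev i) : ℝ) : ℂ) = ev i := fun i => by
    rw [← Complex.ofReal_mul, Real.mul_self_sqrt (hpos i)]
  let U : Matrix n n ℂ := V * (P * Vᴴ * Xᴴ)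
  have hUH : Uᴴ = X * V * P * Vᴴ := by
    simp only [U, Matrix.conjTranspose_mul, Matrix.conjTranspose_conjTranspose, hP, mul_assoc]
  refine ⟨U, ?_, ?_⟩
  · rw [← Matrix.l2_opNorm_conjTranspose]
    apply norm_le_one_of_conjTranspose_mul_self
    rw [Matrix.conjTranspose_conjTranspose, hUH]
    have e : U * (X * V * P * Vᴴ) =
        V * Matrix.diagonal (fun i => (((√(ev i) : ℝ) : ℂ)⁻¹ * ev i * ((√(ev i) : ℝ) : ℂ)⁻¹)) * Vᴴ := by
      calc U * (X * V * P * Vᴴ) = V * P * Vᴴ * (Xᴴ * X) * V * P * Vᴴ := by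
            simp only [U, mul_assoc]
        _ = V * P * (Vᴴ * V) * Matrix.diagonal (fun i => (ev i : ℂ)) * (Vᴴ * V) * P * Vᴴ := by
            rw [hX]; simp only [mul_assoc]
        _ = V * (P * Matrix.diagonal (fun i => (ev i : ℂ)) * P) * Vᴴ := by
            rw [hV]; simp only [mul_assoc, one_mul]
        _ = _ := by simp only [P, Matrix.diagonal_mul_diagonal]
    rw [e]
    have hd : ‖(Matrix.diagonal (fun i => (((√(ev i) : ℝ) : ℂ)⁻¹ * ev i * ((√(ev i) : ℝ) : ℂ)⁻¹)) :
        Matrix n n ℂ)‖ ≤ 1 := by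
      rw [Matrix.l2_opNorm_diagonal, pi_norm_le_iff_of_nonneg zero_le_one]
      intro i
      rw [← hsq i]
      by_cases h0 : ((√(ev i) : ℝ) : ℂ) = 0
      · simp [h0]
      · rw [← mul_assoc, inv_mul_cancel₀ h0, one_mul, mul_inv_cancel₀ h0, norm_one]
    have hVn := norm_le_one_of_isometry hV
    calc _ ≤ ‖V‖ * ‖(Matrix.diagonal (fun i => (((√(ev i) : ℝ) : ℂ)⁻¹ * ev i * ((√(ev i) : ℝ) : ℂ)⁻¹)) :
        Matrix n n ℂ)‖ * ‖Vᴴ‖ := norm_mul₃_le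
      _ ≤ 1 * 1 * 1 := by
          rw [Matrix.l2_opNorm_conjTranspose]
          gcongr
      _ = 1 := by norm_num
  · calc (U * X).trace = (V * (P * Vᴴ * (Xᴴ * X))).trace := by simp only [U, mul_assoc]
      _ = (V * (P * (Vᴴ * V) * Matrix.diagonal (fun i => (ev i : ℂ)) * Vᴴ)).trace := by
          rw [hX]; simp only [mul_assoc]
      _ = ((Vᴴ * V) * (P * Matrix.diagonal (fun i => (ev i : ℂ)))).trace := by
          rw [hV, Matrix.trace_mul_comm, mul_one, one_mul, mul_assoc, hV, mul_one]
      _ = _ := by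
          rw [hV, one_mul, Matrix.diagonal_mul_diagonal, Matrix.trace_diagonal]
          push_cast
          refine Finset.sum_congr rfl fun i _ => ?_
          rw [← hsq i]
          by_cases h0 : ((√(ev i) : ℝ) : ℂ) = 0
          · simp [h0]
          · field_simp

theorem traceNorm_nonneg (X : Matrix n n ℂ) : 0 ≤ traceNorm X :=
  Finset.sum_nonneg fun _ _ => Real.sqrt_nonneg _

/-- `Φ ⊗ id` has norm at most `c` with respect to the trace norm, for every ancilla; the trace norm
of the output is expressed by duality. -/
def DiamondBound (Φ : Matrix n n ℂ → Matrix n n ℂ) (c : ℝ) : Prop :=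
  ∀ (m : ℕ) (X U : Matrix (n × Fin m) (n × Fin m) ℂ),
    ‖(U * amplify Φ m X).trace‖ ≤ c * (‖U‖ * traceNorm X)

theorem DiamondBound.diamondNorm_le {Φ : Matrix n n ℂ → Matrix n n ℂ} {c : ℝ}
    (h : DiamondBound Φ c) (hc : 0 ≤ c) : diamondNorm Φ ≤ ENNReal.ofReal c := by
  unfold diamondNorm
  refine iSup_le fun m => iSup_le fun X => iSup_le fun hX => ENNReal.ofReal_le_ofReal ?_
  obtain ⟨U, hU, hUX⟩ := exists_trace_mul_eq_traceNorm (amplify Φ m X)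
  have h1 := h m X U
  rw [hUX, Complex.norm_real, Real.norm_of_nonneg (traceNorm_nonneg _)] at h1
  refine h1.trans ?_
  have h2 : ‖U‖ * traceNorm X ≤ 1 * 1 := mul_le_mul hU hX (traceNorm_nonneg _) zero_le_one
  nlinarith

theorem DiamondBound.mono {Φ : Matrix n n ℂ → Matrix n n ℂ} {c d : ℝ} (h : DiamondBound Φ c)
    (hcd : c ≤ d) : DiamondBound Φ d := fun m X U =>
  (h m X U).trans (mul_le_mul_of_nonneg_right hcd (mul_nonneg (norm_nonneg _) (traceNorm_nonneg _)))

theorem DiamondBound.add {Φ Ψ : Matrix n n ℂ → Matrix n n ℂ} {c d : ℝ} (hΦ : DiamondBound Φ c)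
    (hΨ : DiamondBound Ψ d) : DiamondBound (fun ρ => Φ ρ + Ψ ρ) (c + d) := fun m X U => by
  have e : amplify (fun ρ => Φ ρ + Ψ ρ) m X = amplify Φ m X + amplify Ψ m X := by
    ext u v; rfl
  rw [e, mul_add, Matrix.trace_add, add_mul]
  exact (norm_add_le _ _).trans (add_le_add (hΦ m X U) (hΨ m X U))

theorem DiamondBound.smul {Φ : Matrix n n ℂ → Matrix n n ℂ} {c : ℝ} (hΦ : DiamondBound Φ c)
    (a : ℂ) : DiamondBound (fun ρ => a • Φ ρ) (‖a‖ * c) := fun m X U => by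
  have e : amplify (fun ρ => a • Φ ρ) m X = a • amplify Φ m X := by
    ext u v; rfl
  rw [e, Matrix.mul_smul, Matrix.trace_smul, norm_smul, mul_assoc]
  exact mul_le_mul_of_nonneg_left (hΦ m X U) (norm_nonneg _)

theorem DiamondBound.sub {Φ Ψ : Matrix n n ℂ → Matrix n n ℂ} {c d : ℝ} (hΦ : DiamondBound Φ c)
    (hΨ : DiamondBound Ψ d) : DiamondBound (fun ρ => Φ ρ - Ψ ρ) (c + d) := by
  have h := hΦ.add (hΨ.smul (-1))
  simpa [sub_eq_add_neg] using h

theorem DiamondBound.sum {ι : Type*} (s : Finset ι) {Φ : ι → Matrix n n ℂ → Matrix n n ℂ}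
    {c : ι → ℝ} (h : ∀ i, DiamondBound (Φ i) (c i)) :
    DiamondBound (fun ρ => ∑ i ∈ s, Φ i ρ) (∑ i ∈ s, c i) := by
  classical
  induction s using Finset.induction_on with
  | empty =>
    intro m X U
    have e : amplify (fun _ : Matrix n n ℂ => (0 : Matrix n n ℂ)) m X = 0 := by ext u v; rfl
    simp [e]
  | insert i s hi ih =>
    simp only [Finset.sum_insert hi]
    exact (h i).add ih

/-- Tensoring with the identity is a star homomorphism of C*-algebras, hence contractive. -/
theorem norm_kronecker_one_le (M : Matrix n n ℂ) (m : ℕ) :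
    ‖(M ⊗ₖ (1 : Matrix (Fin m) (Fin m) ℂ))‖ ≤ ‖M‖ := by
  let φ : Matrix n n ℂ →⋆ₙₐ[ℂ] Matrix (n × Fin m) (n × Fin m) ℂ :=
    { toFun := fun M => M ⊗ₖ (1 : Matrix (Fin m) (Fin m) ℂ)
      map_smul' := fun c M => Matrix.smul_kronecker c M _
      map_zero' := Matrix.zero_kronecker _
      map_add' := fun M N => Matrix.add_kronecker M N _
      map_mul' := fun M N => by rw [← Matrix.mul_kronecker_mul, one_mul]
      map_star' := fun M => by
        rw [Matrix.star_eq_conjTranspose, Matrix.star_eq_conjTranspose,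
          Matrix.conjTranspose_kronecker, Matrix.conjTranspose_one] }
  exact NonUnitalStarAlgHom.norm_apply_le φ M

set_option linter.unusedSectionVars false in
theorem amplify_sandwich (M N : Matrix n n ℂ) (m : ℕ) (X : Matrix (n × Fin m) (n × Fin m) ℂ) :
    amplify (fun ρ => M * ρ * N) m X =
      (M ⊗ₖ (1 : Matrix (Fin m) (Fin m) ℂ)) * X * (N ⊗ₖ (1 : Matrix (Fin m) (Fin m) ℂ)) := by
  ext ⟨i, a⟩ ⟨j, b⟩
  simp [amplify, Matrix.mul_apply, Fintype.sum_prod_type, Matrix.one_apply, Finset.sum_mul,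
    Matrix.kroneckerMap_apply]

/-- Cyclicity of the trace moves both factors onto the dual variable `U`, where only operator norms
enter. All other diamond estimates are assembled from this one. -/
theorem diamondBound_sandwich (M N : Matrix n n ℂ) :
    DiamondBound (fun ρ => M * ρ * N) (‖M‖ * ‖N‖) := fun m X U => by
  rw [amplify_sandwich, ← mul_assoc, Matrix.trace_mul_comm, ← mul_assoc, ← mul_assoc]
  refine (norm_trace_mul_le _ _).trans ?_
  rw [← mul_assoc]
  refine mul_le_mul_of_nonneg_right ?_ (traceNorm_nonneg _)
  refine norm_mul₃_le.trans ?_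
  calc _ ≤ ‖N‖ * ‖U‖ * ‖M‖ := by
        gcongr <;> exact norm_kronecker_one_le _ _
    _ = _ := by ring

theorem diamondBound_mul_left (M : Matrix n n ℂ) : DiamondBound (fun ρ => M * ρ) ‖M‖ := by
  have h := (diamondBound_sandwich M 1).mono
    (mul_le_of_le_one_right (norm_nonneg M) (norm_one_le (n := n)))
  simpa using h

theorem diamondBound_mul_right (M : Matrix n n ℂ) : DiamondBound (fun ρ => ρ * M) ‖M‖ := by
  have h := (diamondBound_sandwich 1 M).mono
    (mul_le_of_le_one_left (norm_nonneg M) (norm_one_le (n := n)))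
  simpa using h

/-- Evaluation of a matrix entry as a continuous linear functional. -/
def entryCLM (i j : n) : Matrix n n ℂ →L[ℂ] ℂ :=
  (Matrix.entryLinearMap ℂ ℂ i j).mkContinuousOfExistsBound <| by
    obtain ⟨c, -, hc⟩ := (LinearMap.toContinuousLinearMap (Matrix.entryLinearMap ℂ ℂ i j :
      Matrix n n ℂ →ₗ[ℂ] ℂ)).isBoundedLinearMap.bound
    exact ⟨c, hc⟩

theorem integrable_entry {α : Type*} [MeasurableSpace α] {μ : Measure α} {f : α → Matrix n n ℂ}
    (hf : Integrable f μ) (i j : n) : Integrable (fun x => f x i j) μ :=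
  (entryCLM i j).integrable_comp hf

theorem integral_entry {α : Type*} [MeasurableSpace α] {μ : Measure α} {f : α → Matrix n n ℂ}
    (hf : Integrable f μ) (i j : n) : (∫ x, f x ∂μ) i j = ∫ x, f x i j ∂μ :=
  ((entryCLM i j).integral_comp_comm hf).symm

/-- For fixed `X` and `U` the dual pairing is a finite linear combination of matrix entries, so it
commutes with the integral. The triangle inequality for scalar integrals then suffices. -/
theorem DiamondBound.integral {α : Type*} [MeasurableSpace α] {μ : Measure α}
    {Φ : α → Matrix n n ℂ → Matrix n n ℂ} {c : α → ℝ} (hΦ : ∀ ρ, Integrable (fun x => Φ x ρ) μ)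
    (hc : Integrable c μ) (h : ∀ x, DiamondBound (Φ x) (c x)) :
    DiamondBound (fun ρ => ∫ x, Φ x ρ ∂μ) (∫ x, c x ∂μ) := fun m X U => by
  have hint : ∀ u v, Integrable (fun x => U u v * amplify (Φ x) m X v u) μ := fun u v =>
    (integrable_entry (hΦ _) _ _).const_mul _
  have e : (U * amplify (fun ρ => ∫ x, Φ x ρ ∂μ) m X).trace =
      ∫ x, (U * amplify (Φ x) m X).trace ∂μ := by
    simp only [Matrix.trace, Matrix.diag_apply, Matrix.mul_apply]
    rw [integral_finsetSum _ fun u _ => integrable_finsetSum _ fun v _ => hint u v]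
    refine Finset.sum_congr rfl fun u _ => ?_
    rw [integral_finsetSum _ fun v _ => hint u v]
    refine Finset.sum_congr rfl fun v _ => ?_
    rw [integral_const_mul]
    congr 1
    exact integral_entry (hΦ _) _ _
  rw [e, ← integral_mul_const]
  exact norm_integral_le_of_norm_le (hc.mul_const _) (Filter.Eventually.of_forall fun x => h x m X U)

end TraceNorm

/-! ### Decay and integrability of the kernels. -/

section Gaussian

theorem integrable_exp_neg_sq_mul_exp_abs {a : ℝ} (ha : 0 < a) (b : ℝ) :
    Integrable fun s : ℝ => Real.exp (-(a * s ^ 2)) * Real.exp (b * |s|) := by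
  have h := (integrable_exp_neg_mul_sq (half_pos ha)).const_mul (Real.exp (b ^ 2 / (2 * a)))
  refine h.mono' (by fun_prop) (Filter.Eventually.of_forall fun s => ?_)
  rw [Real.norm_of_nonneg (by positivity), ← Real.exp_add, ← Real.exp_add]
  refine Real.exp_le_exp.2 ?_
  have h1 : b ^ 2 / (2 * a) + -(a / 2) * s ^ 2 - (-(a * s ^ 2) + b * |s|) =
      (b - a * |s|) ^ 2 / (2 * a) := by
    field_simp
    rw [← sq_abs s]
    ring
  have h2 : 0 ≤ (b - a * |s|) ^ 2 / (2 * a) := by positivity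
  linarith

theorem integrable_exp_neg_abs : Integrable fun t : ℝ => Real.exp (-|t|) := by
  refine (integrable_inv_one_add_sq.const_mul 2).mono' (by fun_prop)
    (Filter.Eventually.of_forall fun t => ?_)
  rw [Real.norm_of_nonneg (Real.exp_nonneg _), Real.exp_neg, ← div_eq_mul_inv, inv_eq_one_div]
  have h := Real.quadratic_le_exp_of_nonneg (abs_nonneg t)
  rw [sq_abs] at h
  rw [div_le_div_iff₀ (Real.exp_pos _) (by positivity)]
  linarith [abs_nonneg t]

theorem inv_cosh_le (x : ℝ) : (Real.cosh x)⁻¹ ≤ 2 * Real.exp (-|x|) := by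
  rw [Real.exp_neg, ← div_eq_mul_inv, inv_eq_one_div,
    div_le_div_iff₀ (Real.cosh_pos x) (Real.exp_pos _), one_mul, ← Real.cosh_abs, Real.cosh_eq]
  linarith [Real.exp_pos (-|x|)]

/-- After translation `t` occurs only in the hyperbolic cosine, which provides decay in `t`; the
Gaussian pays for the shift by `u`. -/
theorem cohOuter_eq (t : ℝ) : cohOuter t =
    ∫ u : ℝ, Real.sin u * Real.exp (-(2 * u ^ 2)) / Real.cosh (2 * Real.pi * (u + t)) := by
  unfold cohOuter
  rw [← integral_add_right_eq_self _ t]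
  simp

theorem norm_cohOuter_integrand_le (t u : ℝ) :
    ‖Real.sin u * Real.exp (-(2 * u ^ 2)) / Real.cosh (2 * Real.pi * (u + t))‖ ≤
      2 * Real.exp (-(2 * |t|)) * (Real.exp (-(2 * u ^ 2)) * Real.exp (2 * |u|)) := by
  have h1 : (Real.cosh (2 * Real.pi * (u + t)))⁻¹ ≤
      2 * (Real.exp (-(2 * |t|)) * Real.exp (2 * |u|)) := by
    refine (inv_cosh_le _).trans ?_
    rw [← Real.exp_add]
    gcongr
    have hpi := Real.pi_gt_three
    rw [abs_mul, abs_of_pos (by positivity : 0 < 2 * Real.pi)]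
    have h2 : |t| ≤ |u + t| + |u| := by
      have := abs_sub (u + t) u
      rwa [add_sub_cancel_left] at this
    nlinarith [abs_nonneg (u + t)]
  rw [norm_div, norm_mul, Real.norm_eq_abs, Real.norm_of_nonneg (Real.exp_nonneg _),
    Real.norm_of_nonneg (Real.cosh_pos _).le, div_eq_mul_inv]
  calc _ ≤ 1 * Real.exp (-(2 * u ^ 2)) * (2 * (Real.exp (-(2 * |t|)) * Real.exp (2 * |u|))) := by
        have := Real.cosh_pos (2 * Real.pi * (u + t))
        gcongr
        exact Real.abs_sin_le_one u
    _ = _ := by ring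

theorem continuous_cohOuter : Continuous cohOuter := by
  rw [show cohOuter = _ from funext cohOuter_eq]
  refine continuous_of_dominated
    (bound := fun u => 2 * (Real.exp (-(2 * u ^ 2)) * Real.exp (2 * |u|)))
    (fun t => ?_) (fun t => Filter.Eventually.of_forall fun u => ?_)
    ((integrable_exp_neg_sq_mul_exp_abs two_pos 2).const_mul 2)
    (Filter.Eventually.of_forall fun u => ?_)
  · refine Continuous.aestronglyMeasurable (Continuous.div (by fun_prop) ?_
      fun u => (Real.cosh_pos _).ne')
    exact Real.continuous_cosh.comp (by fun_prop)
  · refine (norm_cohOuter_integrand_le t u).trans ?_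
    have : Real.exp (-(2 * |t|)) ≤ 1 := Real.exp_le_one_iff.2 (by linarith [abs_nonneg t])
    have h0 : 0 ≤ Real.exp (-(2 * u ^ 2)) * Real.exp (2 * |u|) := by positivity
    nlinarith
  · refine Continuous.div (by fun_prop) ?_ fun u => (Real.cosh_pos _).ne'
    exact Real.continuous_cosh.comp (by fun_prop)

/-- Rate `2` leaves `exp (-|t|)` after the weight `exp |t|` of the evolution error is taken into
account. -/
theorem exists_abs_cohOuter_le : ∃ c : ℝ, 0 ≤ c ∧ ∀ t, |cohOuter t| ≤ c * Real.exp (-(2 * |t|)) := by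
  refine ⟨2 * ∫ u : ℝ, Real.exp (-(2 * u ^ 2)) * Real.exp (2 * |u|), ?_, fun t => ?_⟩
  · exact mul_nonneg zero_le_two (integral_nonneg fun u => by positivity)
  · rw [cohOuter_eq, ← Real.norm_eq_abs]
    refine (norm_integral_le_of_norm_le
      ((integrable_exp_neg_sq_mul_exp_abs two_pos 2).const_mul (2 * Real.exp (-(2 * |t|))))
      (Filter.Eventually.of_forall fun u => norm_cohOuter_integrand_le t u)).trans_eq ?_
    rw [integral_const_mul]
    ring

theorem integrable_abs_cohOuter_mul_exp_abs :
    Integrable fun t : ℝ => |cohOuter t| * Real.exp |t| := by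
  obtain ⟨c, hc0, hc⟩ := exists_abs_cohOuter_le
  have hm := continuous_cohOuter
  refine (integrable_exp_neg_abs.const_mul c).mono' (by fun_prop)
    (Filter.Eventually.of_forall fun t => ?_)
  rw [Real.norm_of_nonneg (by positivity)]
  calc _ ≤ c * Real.exp (-(2 * |t|)) * Real.exp |t| := by gcongr; exact hc t
    _ = _ := by rw [mul_assoc, ← Real.exp_add]; ring_nf

theorem integrable_cohOuter : Integrable cohOuter := by
  have hm := continuous_cohOuter
  refine integrable_abs_cohOuter_mul_exp_abs.mono' (by fun_prop)
    (Filter.Eventually.of_forall fun t => ?_)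
  exact le_mul_of_one_le_right (abs_nonneg _) (Real.one_le_exp (abs_nonneg t))

theorem norm_cohInner (t : ℝ) :
    ‖cohInner t‖ = Real.exp (1 / 8) / Real.pi * Real.exp (-(4 * t ^ 2)) := by
  unfold cohInner
  rw [norm_mul, Complex.norm_exp]
  congr 1
  · rw [← Complex.ofReal_div, Complex.norm_real, Real.norm_of_nonneg (by positivity)]
  · congr 1
    have : (4 * (t : ℂ) ^ 2) = ((4 * t ^ 2 : ℝ) : ℂ) := by push_cast; ring
    rw [this, Complex.sub_re, Complex.neg_re, Complex.ofReal_re]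
    simp

theorem continuous_cohInner : Continuous cohInner := by
  unfold cohInner
  fun_prop

/-- This symmetry makes the coherent term Hermitian. -/
theorem conj_cohInner (t : ℝ) : star (cohInner t) = cohInner (-t) := by
  unfold cohInner
  rw [Complex.star_def, map_mul, ← Complex.exp_conj]
  congr 1
  · rw [← Complex.ofReal_div, Complex.conj_ofReal]
  · congr 1
    have h4 : (starRingEnd ℂ) 4 = 4 := Complex.conj_ofNat 4
    have h2 : (starRingEnd ℂ) 2 = 2 := Complex.conj_ofNat 2
    simp [h4, h2]

theorem integrable_norm_cohInner_mul_exp_abs :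
    Integrable fun t : ℝ => ‖cohInner t‖ * Real.exp |t| := by
  have h := (integrable_exp_neg_sq_mul_exp_abs four_pos 1).const_mul
    (Real.exp (1 / 8) / Real.pi)
  simpa only [norm_cohInner, one_mul, mul_assoc] using h

theorem integrable_cohInner : Integrable cohInner := by
  refine integrable_norm_cohInner_mul_exp_abs.mono' continuous_cohInner.aestronglyMeasurable
    (Filter.Eventually.of_forall fun t => ?_)
  exact le_mul_of_one_le_right (norm_nonneg _) (Real.one_le_exp (abs_nonneg t))

theorem continuous_transWeight (β : ℝ) : Continuous (transWeight β) := by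
  unfold transWeight
  fun_prop

theorem transWeight_eq {β : ℝ} (hβ : β ≠ 0) (ω : ℝ) :
    transWeight β ω = (fun x => Real.exp (-(1 / 2) * (x + β⁻¹ * β) ^ 2)) (ω * β) := by
  unfold transWeight
  rw [inv_mul_cancel₀ hβ]
  congr 1
  ring

theorem integrable_transWeight {β : ℝ} (hβ : β ≠ 0) : Integrable (transWeight β) := by
  have h := ((integrable_exp_neg_mul_sq (b := 1 / 2) (by norm_num)).comp_add_right
    (β⁻¹ * β)).comp_mul_right' hβ
  exact h.congr (Filter.Eventually.of_forall fun ω => (transWeight_eq hβ ω).symm)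

theorem integral_transWeight {β : ℝ} (hβ : 0 < β) :
    ∫ ω, transWeight β ω = √(2 * Real.pi) / β := by
  simp only [transWeight_eq hβ.ne']
  rw [Measure.integral_comp_mul_right (fun x => Real.exp (-(1 / 2) * (x + β⁻¹ * β) ^ 2)),
    integral_add_right_eq_self (fun x => Real.exp (-(1 / 2) * x ^ 2)), integral_gaussian,
    abs_of_pos (inv_pos.2 hβ), smul_eq_mul]
  rw [show Real.pi / (1 / 2) = 2 * Real.pi by ring]
  ring

theorem gaussFilter_nonneg (β t : ℝ) : 0 ≤ gaussFilter β t := by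
  unfold gaussFilter; positivity

theorem continuous_gaussFilter (β : ℝ) : Continuous (gaussFilter β) := by
  unfold gaussFilter
  fun_prop

theorem gaussFilter_mul_exp_eq {β : ℝ} (t : ℝ) :
    gaussFilter β t * Real.exp |t / β| =
      (√(β * √(Real.pi / 2)))⁻¹ *
        (fun s => Real.exp (-(1 * s ^ 2)) * Real.exp (1 * |s|)) (t / β) := by
  unfold gaussFilter
  simp only [one_mul, div_pow]
  ring

theorem integrable_gaussFilter_mul_exp {β : ℝ} (hβ : 0 < β) :
    Integrable fun t => gaussFilter β t * Real.exp |t / β| := by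
  simp only [gaussFilter_mul_exp_eq]
  exact ((integrable_exp_neg_sq_mul_exp_abs one_pos 1).comp_div hβ.ne').const_mul _

/-- The weighted integral of the unit-width Gaussian filter. -/
def filterConst : ℝ :=
  (√(√(Real.pi / 2)))⁻¹ * ∫ s : ℝ, Real.exp (-(1 * s ^ 2)) * Real.exp (1 * |s|)

theorem filterConst_nonneg : 0 ≤ filterConst :=
  mul_nonneg (by positivity) (integral_nonneg fun s => by positivity)

/-- The `√β` is the scaling of an `L²`-normalised filter in `L¹`. It enters quadratically in the
dissipator and cancels the `1/β` of `integral_transWeight`. -/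
theorem integral_gaussFilter_mul_exp {β : ℝ} (hβ : 0 < β) :
    ∫ t, gaussFilter β t * Real.exp |t / β| = √β * filterConst := by
  simp only [gaussFilter_mul_exp_eq]
  rw [integral_const_mul, Measure.integral_comp_div
    (fun s => Real.exp (-(1 * s ^ 2)) * Real.exp (1 * |s|)), abs_of_pos hβ, smul_eq_mul,
    filterConst, Real.sqrt_mul hβ.le, mul_inv]
  have h : (√β)⁻¹ * β = √β := by
    have h1 : 0 < √β := Real.sqrt_pos.2 hβ
    have h2 := Real.mul_self_sqrt hβ.le
    field_simp
    linarith
  linear_combination (√(√(Real.pi / 2)))⁻¹ *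
    (∫ s : ℝ, Real.exp (-(1 * s ^ 2)) * Real.exp (1 * |s|)) * h

end Gaussian

/-! ### Stability of the generator under a change of Hamiltonian. -/

section JumpEstimates

variable {n : Type*} [Fintype n] [DecidableEq n]

theorem norm_filter_phase (β ω t : ℝ) :
    ‖(gaussFilter β t : ℂ) * Complex.exp (-(Complex.I * ω * t))‖ = gaussFilter β t := by
  rw [norm_mul, Complex.norm_real, Real.norm_of_nonneg (gaussFilter_nonneg _ _), Complex.norm_exp]
  simp

theorem continuous_filter_phase (β ω : ℝ) :
    Continuous fun t : ℝ => (gaussFilter β t : ℂ) * Complex.exp (-(Complex.I * ω * t)) := by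
  have := continuous_gaussFilter β
  fun_prop

theorem norm_filter_phase_smul_le {β : ℝ} (hβ : 0 < β) {F : ℝ → Matrix n n ℂ} {q : ℝ}
    (hq : ∀ s, ‖F (β * s)‖ ≤ q * Real.exp |s|) (ω t : ℝ) :
    ‖((gaussFilter β t : ℂ) * Complex.exp (-(Complex.I * ω * t))) • F t‖ ≤
      q * (gaussFilter β t * Real.exp |t / β|) := by
  have h := hq (t / β)
  rw [mul_div_cancel₀ _ hβ.ne'] at h
  rw [norm_smul, norm_filter_phase]
  calc _ ≤ gaussFilter β t * (q * Real.exp |t / β|) :=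
        mul_le_mul_of_nonneg_left h (gaussFilter_nonneg _ _)
    _ = _ := by ring

theorem integrable_filter_phase_smul {β : ℝ} (hβ : 0 < β) {F : ℝ → Matrix n n ℂ} {q : ℝ}
    (hF : Continuous F) (hq : ∀ s, ‖F (β * s)‖ ≤ q * Real.exp |s|) (ω : ℝ) :
    Integrable fun t : ℝ =>
      ((gaussFilter β t : ℂ) * Complex.exp (-(Complex.I * ω * t))) • F t :=
  ((integrable_gaussFilter_mul_exp hβ).const_mul q).mono'
    ((continuous_filter_phase β ω).smul hF).aestronglyMeasurable
    (Filter.Eventually.of_forall fun t => norm_filter_phase_smul_le hβ hq ω t)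

/-- Allowing growth `exp |s|` in the rescaled time `s = t/β` covers two cases at once: `F` an
evolved operator, and `F` a difference of two evolutions. -/
theorem norm_filtered_integral_le {β : ℝ} (hβ : 0 < β) {F : ℝ → Matrix n n ℂ} {q : ℝ}
    (hq : ∀ s, ‖F (β * s)‖ ≤ q * Real.exp |s|) (ω : ℝ) :
    ‖(1 / √(2 * Real.pi) : ℂ) • ∫ t : ℝ,
      ((gaussFilter β t : ℂ) * Complex.exp (-(Complex.I * ω * t))) • F t‖ ≤
        q * (√β * filterConst) := by
  have hq0 : 0 ≤ q := by
    have h := hq 0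
    simp only [abs_zero, Real.exp_zero, mul_one] at h
    exact (norm_nonneg _).trans h
  have h1 : ‖(1 / √(2 * Real.pi) : ℂ)‖ ≤ 1 := by
    rw [norm_div, norm_one, Complex.norm_real, Real.norm_of_nonneg (Real.sqrt_nonneg _)]
    refine div_le_one_of_le₀ ?_ (Real.sqrt_nonneg _)
    rw [Real.one_le_sqrt]
    linarith [Real.pi_gt_three]
  rw [norm_smul]
  refine (mul_le_of_le_one_left (norm_nonneg _) h1).trans ?_
  refine (norm_integral_le_of_norm_le ((integrable_gaussFilter_mul_exp hβ).const_mul q)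
    (Filter.Eventually.of_forall fun t => norm_filter_phase_smul_le hβ hq ω t)).trans_eq ?_
  rw [integral_const_mul, integral_gaussFilter_mul_exp hβ]

theorem norm_evolve_le_mul_exp {H A : Matrix n n ℂ} (hH : H.IsHermitian) {g : ℝ} (hA : ‖A‖ ≤ g)
    (t s : ℝ) : ‖evolve H t A‖ ≤ g * Real.exp |s| :=
  ((norm_evolve_le hH _ _).trans hA).trans
    (le_mul_of_one_le_right ((norm_nonneg _).trans hA) (Real.one_le_exp (abs_nonneg s)))

theorem norm_jumpFourier_le {H A : Matrix n n ℂ} (hH : H.IsHermitian) {β g : ℝ} (hβ : 0 < β)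
    (hA : ‖A‖ ≤ g) (ω : ℝ) : ‖jumpFourier H β ω A‖ ≤ g * (√β * filterConst) := by
  unfold jumpFourier
  exact norm_filtered_integral_le (F := fun t => evolve H t A) hβ
    (fun s => norm_evolve_le_mul_exp hH hA (β * s) s) ω

theorem norm_jumpFourier_sub_le {H H' A : Matrix n n ℂ} (hH : H.IsHermitian)
    (hH' : H'.IsHermitian) {β q : ℝ} (hβ : 0 < β)
    (hq : ∀ s, ‖evolve H (β * s) A - evolve H' (β * s) A‖ ≤ q * Real.exp |s|) (ω : ℝ) :
    ‖jumpFourier H β ω A - jumpFourier H' β ω A‖ ≤ q * (√β * filterConst) := by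
  have hi := fun {H : Matrix n n ℂ} (hH : H.IsHermitian) =>
    integrable_filter_phase_smul (F := fun t => evolve H t A) hβ (continuous_evolve H A)
      (fun s => norm_evolve_le_mul_exp hH le_rfl (β * s) s) ω
  unfold jumpFourier
  rw [← smul_sub, ← integral_sub (hi hH) (hi hH')]
  simp only [← smul_sub]
  exact norm_filtered_integral_le (F := fun t => evolve H t A - evolve H' t A) hβ hq ω

theorem continuous_jumpFourier {H A : Matrix n n ℂ} (hH : H.IsHermitian) {β : ℝ} (hβ : 0 < β) :
    Continuous fun ω => jumpFourier H β ω A := by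
  have hq := fun s => norm_evolve_le_mul_exp (A := A) hH le_rfl (β * s) s
  have hc : Continuous fun ω : ℝ => ∫ t : ℝ,
      ((gaussFilter β t : ℂ) * Complex.exp (-(Complex.I * ω * t))) • evolve H t A := by
    refine continuous_of_dominated
      (fun ω => (integrable_filter_phase_smul (F := fun t => evolve H t A) hβ
        (continuous_evolve H A) hq ω).aestronglyMeasurable)
      (fun ω => Filter.Eventually.of_forall fun t =>
        norm_filter_phase_smul_le (F := fun t => evolve H t A) hβ hq ω t)
      ((integrable_gaussFilter_mul_exp hβ).const_mul ‖A‖)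
      (Filter.Eventually.of_forall fun t => ?_)
    have h : Continuous fun ω : ℝ =>
        (gaussFilter β t : ℂ) * Complex.exp (-(Complex.I * ω * t)) := by fun_prop
    exact h.smul continuous_const
  exact hc.const_smul (1 / √(2 * Real.pi) : ℂ)

/-! ### The dissipative part -/

theorem norm_dissipator_le (L ρ : Matrix n n ℂ) : ‖dissipator L ρ‖ ≤ 2 * (‖L‖ * ‖L‖) * ‖ρ‖ := by
  unfold dissipator
  have h1 : ‖L * ρ * Lᴴ‖ ≤ ‖L‖ * ‖ρ‖ * ‖L‖ := by
    have := norm_mul₃_le (a := L) (b := ρ) (c := Lᴴ)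
    rwa [Matrix.l2_opNorm_conjTranspose] at this
  have h2 : ‖Lᴴ * L * ρ‖ ≤ ‖L‖ * ‖L‖ * ‖ρ‖ := by
    have := norm_mul_le (Lᴴ * L) ρ
    rwa [Matrix.l2_opNorm_conjTranspose_mul_self] at this
  have h3 : ‖ρ * (Lᴴ * L)‖ ≤ ‖ρ‖ * (‖L‖ * ‖L‖) := by
    have := norm_mul_le ρ (Lᴴ * L)
    rwa [Matrix.l2_opNorm_conjTranspose_mul_self] at this
  have h4 : ‖(1 / 2 : ℂ) • (Lᴴ * L * ρ + ρ * (Lᴴ * L))‖ ≤ 1 / 2 * (‖L‖ * ‖L‖ * ‖ρ‖ +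
      ‖ρ‖ * (‖L‖ * ‖L‖)) := by
    rw [norm_smul]
    have : ‖(1 / 2 : ℂ)‖ = 1 / 2 := by norm_num
    rw [this]
    gcongr
    exact (norm_add_le _ _).trans (add_le_add h2 h3)
  refine (norm_sub_le _ _).trans ((add_le_add h1 h4).trans_eq ?_)
  ring

set_option linter.unusedSectionVars false in
theorem continuous_dissipator {L : ℝ → Matrix n n ℂ} (hL : Continuous L) (ρ : Matrix n n ℂ) :
    Continuous fun ω => dissipator (L ω) ρ := by
  unfold dissipator
  have h : Continuous fun ω => (L ω)ᴴ := hL.star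
  fun_prop

theorem integrable_weighted_dissipator {γ : ℝ → ℝ} (hγ : Continuous γ) (hγi : Integrable γ)
    {L : ℝ → Matrix n n ℂ} (hL : Continuous L) {b : ℝ} (hb : ∀ ω, ‖L ω‖ ≤ b)
    (ρ : Matrix n n ℂ) : Integrable fun ω => (γ ω : ℂ) • dissipator (L ω) ρ := by
  have hc := continuous_dissipator hL ρ
  refine (hγi.norm.mul_const (2 * (b * b) * ‖ρ‖)).mono'
    (Continuous.aestronglyMeasurable (by fun_prop)) (Filter.Eventually.of_forall fun ω => ?_)
  rw [norm_smul, Complex.norm_real]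
  refine mul_le_mul_of_nonneg_left ((norm_dissipator_le _ _).trans ?_) (norm_nonneg _)
  have := hb ω
  have h0 := (norm_nonneg _).trans this
  gcongr

theorem diamondBound_commutator (G : Matrix n n ℂ) :
    DiamondBound (fun ρ => G * ρ - ρ * G) (2 * ‖G‖) :=
  ((diamondBound_mul_left G).sub (diamondBound_mul_right G)).mono (by linarith)

/-- Both the jump term and `L†L` are quadratic in `L`, so telescoping leaves one factor `L - L'` in
each summand. -/
theorem diamondBound_dissipator_sub (L L' : Matrix n n ℂ) :
    DiamondBound (fun ρ => dissipator L ρ - dissipator L' ρ)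
      (2 * ((‖L‖ + ‖L'‖) * ‖L - L'‖)) := by
  set K := Lᴴ * L - L'ᴴ * L'
  have hK : ‖K‖ ≤ (‖L‖ + ‖L'‖) * ‖L - L'‖ := by
    have e : K = Lᴴ * (L - L') + (L - L')ᴴ * L' := by
      simp only [K, Matrix.conjTranspose_sub]; noncomm_ring
    rw [e]
    refine (norm_add_le _ _).trans ?_
    have h1 := norm_mul_le Lᴴ (L - L')
    have h2 := norm_mul_le (L - L')ᴴ L'
    rw [Matrix.l2_opNorm_conjTranspose] at h1 h2
    linarith
  have h := ((diamondBound_sandwich (L - L') Lᴴ).add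
    (diamondBound_sandwich L' (L - L')ᴴ)).sub
      (((diamondBound_mul_left K).add (diamondBound_mul_right K)).smul (1 / 2))
  have e : (fun ρ => dissipator L ρ - dissipator L' ρ) = fun ρ =>
      (L - L') * ρ * Lᴴ + L' * ρ * (L - L')ᴴ - (1 / 2 : ℂ) • (K * ρ + ρ * K) := by
    ext1 ρ
    simp only [dissipator, K, Matrix.conjTranspose_sub, sub_mul, mul_sub, smul_sub, smul_add]
    abel
  rw [e]
  refine h.mono ?_
  rw [Matrix.l2_opNorm_conjTranspose, Matrix.l2_opNorm_conjTranspose]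
  have : ‖(1 / 2 : ℂ)‖ = 1 / 2 := by norm_num
  rw [this]
  linarith

/-! ### The coherent part -/

theorem continuous_coherent_inner (H A : Matrix n n ℂ) (β : ℝ) : Continuous fun t' : ℝ =>
    cohInner t' • (evolve H (β * t') Aᴴ * evolve H (-(β * t')) A) := by
  have h1 := (continuous_evolve H Aᴴ).comp (continuous_const_mul β)
  have h2 := (continuous_evolve H A).comp (continuous_const_mul β).neg
  exact continuous_cohInner.smul (h1.mul h2)

theorem norm_coherent_inner_le {H A : Matrix n n ℂ} (hH : H.IsHermitian) {g : ℝ} (hA : ‖A‖ ≤ g)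
    (β t' : ℝ) : ‖cohInner t' • (evolve H (β * t') Aᴴ * evolve H (-(β * t')) A)‖ ≤
      ‖cohInner t'‖ * (g * g) := by
  rw [norm_smul]
  refine mul_le_mul_of_nonneg_left ?_ (norm_nonneg _)
  refine (norm_mul_le _ _).trans ?_
  have h1 := norm_evolve_le hH (β * t') Aᴴ
  rw [Matrix.l2_opNorm_conjTranspose] at h1
  exact mul_le_mul (h1.trans hA) ((norm_evolve_le hH _ _).trans hA) (norm_nonneg _)
    ((norm_nonneg _).trans hA)

theorem integrable_coherent_inner {H : Matrix n n ℂ} (hH : H.IsHermitian) (A : Matrix n n ℂ)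
    (β : ℝ) : Integrable fun t' : ℝ =>
      cohInner t' • (evolve H (β * t') Aᴴ * evolve H (-(β * t')) A) :=
  (integrable_cohInner.norm.mul_const (‖A‖ * ‖A‖)).mono'
    (continuous_coherent_inner H A β).aestronglyMeasurable
    (Filter.Eventually.of_forall fun t' => norm_coherent_inner_le hH le_rfl β t')

/-- Heisenberg evolution as a continuous linear map. -/
def evolveCLM (H : Matrix n n ℂ) (t : ℝ) : Matrix n n ℂ →L[ℂ] Matrix n n ℂ :=
  (ContinuousLinearMap.mul ℂ (Matrix n n ℂ) (propagator H t)).comp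
    ((ContinuousLinearMap.mul ℂ (Matrix n n ℂ)).flip (propagator H (-t)))

theorem evolveCLM_apply (H : Matrix n n ℂ) (t : ℝ) (A : Matrix n n ℂ) :
    evolveCLM H t A = evolve H t A := by
  rw [evolve_eq, mul_assoc]
  rfl

theorem evolve_integral {α : Type*} [MeasurableSpace α] {μ : Measure α} (H : Matrix n n ℂ) (t : ℝ)
    {f : α → Matrix n n ℂ} (hf : Integrable f μ) :
    evolve H t (∫ x, f x ∂μ) = ∫ x, evolve H t (f x) ∂μ := by
  simp only [← evolveCLM_apply]
  exact ((evolveCLM H t).integral_comp_comm hf).symm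

theorem integrable_evolve {α : Type*} [MeasurableSpace α] {μ : Measure α} (H : Matrix n n ℂ)
    (t : ℝ) {f : α → Matrix n n ℂ} (hf : Integrable f μ) :
    Integrable (fun x => evolve H t (f x)) μ := by
  simp only [← evolveCLM_apply]
  exact (evolveCLM H t).integrable_comp hf

/-- The group law merges the outer and inner times into `t' - t` and `-t' - t`. Both are at most
`|t| + |t'|` in modulus, so the weight factorises over the two kernels. The `2` counts the two
evolved factors. -/
theorem norm_coherent_integrand_sub_le {H H' A : Matrix n n ℂ} (hH : H.IsHermitian)
    (hH' : H'.IsHermitian) {β q g : ℝ} (hA : ‖A‖ ≤ g)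
    (hq : ∀ s, ‖evolve H (β * s) A - evolve H' (β * s) A‖ ≤ q * Real.exp |s|) (t t' : ℝ) :
    ‖evolve H (-(β * t)) (cohInner t' • (evolve H (β * t') Aᴴ * evolve H (-(β * t')) A)) -
      evolve H' (-(β * t)) (cohInner t' • (evolve H' (β * t') Aᴴ * evolve H' (-(β * t')) A))‖ ≤
      2 * g * q * Real.exp |t| * (‖cohInner t'‖ * Real.exp |t'|) := by
  have hg : 0 ≤ g := (norm_nonneg _).trans hA
  have hq0 : 0 ≤ q := by
    have h := hq 0
    simp only [abs_zero, Real.exp_zero, mul_one] at h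
    exact (norm_nonneg _).trans h
  have e : ∀ H : Matrix n n ℂ,
      evolve H (-(β * t)) (cohInner t' • (evolve H (β * t') Aᴴ * evolve H (-(β * t')) A)) =
        cohInner t' • (evolve H (β * (t' - t)) Aᴴ * evolve H (β * (-t' - t)) A) := fun H => by
    rw [evolve_smul, evolve_mul, evolve_evolve, evolve_evolve]
    congr 3 <;> ring
  have hqH : ∀ s, ‖evolve H (β * s) Aᴴ - evolve H' (β * s) Aᴴ‖ ≤ q * Real.exp |s| := fun s => by
    rw [← evolve_conjTranspose hH, ← evolve_conjTranspose hH', ← Matrix.conjTranspose_sub,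
      Matrix.l2_opNorm_conjTranspose]
    exact hq s
  have hexp : ∀ s, |s| ≤ |t| + |t'| → q * Real.exp |s| ≤ q * (Real.exp |t| * Real.exp |t'|) :=
    fun s hs => by
      rw [← Real.exp_add]
      gcongr
  have h1 := (hqH (t' - t)).trans (hexp _ ((abs_sub _ _).trans_eq (add_comm _ _)))
  have h2 := (hq (-t' - t)).trans (hexp _ ((abs_sub _ _).trans_eq (by rw [abs_neg, add_comm])))
  have h3 : ‖evolve H (β * (-t' - t)) A‖ ≤ g := (norm_evolve_le hH _ _).trans hA
  have h4 : ‖evolve H' (β * (t' - t)) Aᴴ‖ ≤ g := by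
    refine (norm_evolve_le hH' _ _).trans ?_
    rwa [Matrix.l2_opNorm_conjTranspose]
  rw [e, e, ← smul_sub, norm_smul]
  set P := evolve H (β * (t' - t)) Aᴴ
  set P' := evolve H' (β * (t' - t)) Aᴴ
  set Q := evolve H (β * (-t' - t)) A
  set Q' := evolve H' (β * (-t' - t)) A
  have e2 : P * Q - P' * Q' = (P - P') * Q + P' * (Q - Q') := by noncomm_ring
  rw [e2]
  calc _ ≤ ‖cohInner t'‖ * (‖P - P'‖ * ‖Q‖ + ‖P'‖ * ‖Q - Q'‖) := by
        gcongr
        exact (norm_add_le _ _).trans (add_le_add (norm_mul_le _ _) (norm_mul_le _ _))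
    _ ≤ ‖cohInner t'‖ * (q * (Real.exp |t| * Real.exp |t'|) * g +
          g * (q * (Real.exp |t| * Real.exp |t'|))) := by
        gcongr
    _ = _ := by ring

/-- The total weight of the coherent kernels. -/
def coherentConst : ℝ :=
  (∫ t, |cohOuter t| * Real.exp |t|) * ∫ t', ‖cohInner t'‖ * Real.exp |t'|

theorem coherentConst_nonneg : 0 ≤ coherentConst :=
  mul_nonneg (integral_nonneg fun t => by positivity) (integral_nonneg fun t => by positivity)

theorem integrable_coherent_outer {H : Matrix n n ℂ} (hH : H.IsHermitian) (M : Matrix n n ℂ)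
    (β : ℝ) : Integrable fun t : ℝ => (cohOuter t : ℂ) • evolve H (-(β * t)) M := by
  have hc := (continuous_evolve H M).comp (continuous_const_mul β).neg
  have hc' : Continuous fun t : ℝ => (cohOuter t : ℂ) :=
    Complex.continuous_ofReal.comp continuous_cohOuter
  refine (integrable_cohOuter.norm.mul_const ‖M‖).mono'
    (Continuous.aestronglyMeasurable (hc'.smul hc))
    (Filter.Eventually.of_forall fun t => ?_)
  rw [norm_smul, Complex.norm_real]
  exact mul_le_mul_of_nonneg_left (norm_evolve_le hH _ _) (norm_nonneg _)

theorem norm_coherentTerm_sub_le {H H' A : Matrix n n ℂ} (hH : H.IsHermitian)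
    (hH' : H'.IsHermitian) {β q g : ℝ} (hA : ‖A‖ ≤ g)
    (hq : ∀ s, ‖evolve H (β * s) A - evolve H' (β * s) A‖ ≤ q * Real.exp |s|) :
    ‖coherentTerm H β A - coherentTerm H' β A‖ ≤ 2 * g * q * coherentConst := by
  unfold coherentTerm
  rw [← integral_sub (integrable_coherent_outer hH _ β) (integrable_coherent_outer hH' _ β)]
  refine (norm_integral_le_of_norm_le (integrable_abs_cohOuter_mul_exp_abs.const_mul
    (2 * g * q * ∫ t', ‖cohInner t'‖ * Real.exp |t'|))
    (Filter.Eventually.of_forall fun t => ?_)).trans_eq ?_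
  · have hi := integrable_coherent_inner hH A β
    have hi' := integrable_coherent_inner hH' A β
    rw [← smul_sub, norm_smul, Complex.norm_real, Real.norm_eq_abs, evolve_integral _ _ hi,
      evolve_integral _ _ hi', ← integral_sub (integrable_evolve _ _ hi)
        (integrable_evolve _ _ hi')]
    have h := norm_integral_le_of_norm_le
      (integrable_norm_cohInner_mul_exp_abs.const_mul (2 * g * q * Real.exp |t|))
      (Filter.Eventually.of_forall fun t' =>
        norm_coherent_integrand_sub_le hH hH' hA hq t t')
    refine (mul_le_mul_of_nonneg_left h (abs_nonneg _)).trans_eq ?_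
    rw [integral_const_mul]
    ring
  · rw [integral_const_mul, coherentConst]
    ring

theorem conjTranspose_integral {α : Type*} [MeasurableSpace α] {μ : Measure α}
    (f : α → Matrix n n ℂ) : (∫ x, f x ∂μ)ᴴ = ∫ x, (f x)ᴴ ∂μ :=
  ((starL' ℝ : Matrix n n ℂ ≃L[ℝ] Matrix n n ℂ).integral_comp_comm f).symm

theorem coherentTerm_isHermitian {H : Matrix n n ℂ} (hH : H.IsHermitian) (β : ℝ)
    (A : Matrix n n ℂ) : (coherentTerm H β A).IsHermitian := by
  have hinner : (∫ t' : ℝ, cohInner t' • (evolve H (β * t') Aᴴ * evolve H (-(β * t')) A))ᴴ =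
      ∫ t' : ℝ, cohInner t' • (evolve H (β * t') Aᴴ * evolve H (-(β * t')) A) := by
    -- Taking adjoints exchanges the two evolved factors and conjugates the kernel; the substitution
    -- `t' ↦ -t'` undoes both.
    rw [conjTranspose_integral, ← integral_neg_eq_self]
    congr 1
    ext1 t'
    rw [Matrix.conjTranspose_smul, Matrix.conjTranspose_mul, evolve_conjTranspose hH,
      evolve_conjTranspose hH, Matrix.conjTranspose_conjTranspose, conj_cohInner, neg_neg,
      mul_neg, neg_neg]
  unfold Matrix.IsHermitian coherentTerm
  rw [conjTranspose_integral]
  congr 1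
  ext1 t
  rw [Matrix.conjTranspose_smul, evolve_conjTranspose hH, hinner, Complex.star_def,
    Complex.conj_ofReal]

/-! ### One summand of the Lindbladian -/

/-- The contribution of one jump operator to `chenLindbladian`. -/
def chenTerm (κ : ℝ) (H : Matrix n n ℂ) (β : ℝ) (A ρ : Matrix n n ℂ) : Matrix n n ℂ :=
  -Complex.I • ((κ : ℂ) • (coherentTerm H β A * ρ - ρ * coherentTerm H β A)) +
    ∫ ω : ℝ, (transWeight β ω : ℂ) • dissipator (jumpFourier H β ω A) ρ

theorem chenLindbladian_eq_sum {J : ℕ} (κ : ℝ) (H : Matrix n n ℂ) (β : ℝ)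
    (A : Fin J → Matrix n n ℂ) (ρ : Matrix n n ℂ) :
    chenLindbladian κ H β A ρ = ∑ a, chenTerm κ H β (A a) ρ := by
  simp only [chenLindbladian, chenTerm, Finset.sum_add_distrib, Finset.smul_sum]

theorem integrable_chen_dissipator {H A : Matrix n n ℂ} (hH : H.IsHermitian) {β : ℝ} (hβ : 0 < β)
    (ρ : Matrix n n ℂ) :
    Integrable fun ω => (transWeight β ω : ℂ) • dissipator (jumpFourier H β ω A) ρ :=
  integrable_weighted_dissipator (continuous_transWeight β) (integrable_transWeight hβ.ne')
    (continuous_jumpFourier hH hβ) (fun ω => norm_jumpFourier_le hH hβ le_rfl ω) ρ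

theorem diamondBound_chenTerm_sub {H H' A : Matrix n n ℂ} (κ : ℝ) (hH : H.IsHermitian)
    (hH' : H'.IsHermitian) {β q g : ℝ} (hβ : 0 < β) (hA : ‖A‖ ≤ g)
    (hq : ∀ s, ‖evolve H (β * s) A - evolve H' (β * s) A‖ ≤ q * Real.exp |s|) :
    DiamondBound (fun ρ => chenTerm κ H β A ρ - chenTerm κ H' β A ρ)
      ((4 * |κ| * g * coherentConst + 4 * g * filterConst ^ 2 * √(2 * Real.pi)) * q) := by
  have hg : 0 ≤ g := (norm_nonneg _).trans hA
  have hd := DiamondBound.integral (μ := volume)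
    (Φ := fun ω ρ => (transWeight β ω : ℂ) •
      (dissipator (jumpFourier H β ω A) ρ - dissipator (jumpFourier H' β ω A) ρ))
    (c := fun ω => transWeight β ω * (4 * g * q * (β * filterConst ^ 2)))
    (fun ρ => by
      simp only [smul_sub]
      exact (integrable_chen_dissipator hH hβ ρ).sub (integrable_chen_dissipator hH' hβ ρ))
    ((integrable_transWeight hβ.ne').mul_const _)
    (fun ω => by
      have h0 : 0 ≤ transWeight β ω := (Real.exp_pos _).le
      have h := (diamondBound_dissipator_sub (jumpFourier H β ω A)
        (jumpFourier H' β ω A)).smul (transWeight β ω)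
      rw [Complex.norm_real, Real.norm_of_nonneg h0] at h
      refine h.mono (mul_le_mul_of_nonneg_left ?_ h0)
      have h1 := norm_jumpFourier_le hH hβ hA ω
      have h2 := norm_jumpFourier_le hH' hβ hA ω
      have h3 := norm_jumpFourier_sub_le hH hH' hβ hq ω
      have hf := filterConst_nonneg
      calc _ ≤ 2 * ((g * (√β * filterConst) + g * (√β * filterConst)) *
            (q * (√β * filterConst))) := by gcongr
        _ = 4 * g * q * ((√β * √β) * filterConst ^ 2) := by ring
        _ = _ := by rw [Real.mul_self_sqrt hβ.le])
  have hc := ((diamondBound_commutator (coherentTerm H β A - coherentTerm H' β A)).smul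
    (κ : ℂ)).smul (-Complex.I)
  have e : (fun ρ => chenTerm κ H β A ρ - chenTerm κ H' β A ρ) = fun ρ =>
      -Complex.I • ((κ : ℂ) • ((coherentTerm H β A - coherentTerm H' β A) * ρ -
        ρ * (coherentTerm H β A - coherentTerm H' β A))) +
      ∫ ω : ℝ, (transWeight β ω : ℂ) •
        (dissipator (jumpFourier H β ω A) ρ - dissipator (jumpFourier H' β ω A) ρ) := by
    ext1 ρ
    simp only [smul_sub]
    rw [integral_sub (integrable_chen_dissipator hH hβ ρ) (integrable_chen_dissipator hH' hβ ρ)]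
    simp only [chenTerm, sub_mul, mul_sub, smul_sub]
    abel
  rw [e]
  refine (hc.add hd).mono ?_
  have hk := norm_coherentTerm_sub_le hH hH' hA hq
  rw [norm_neg, Complex.norm_I, Complex.norm_real, Real.norm_eq_abs, integral_mul_const,
    integral_transWeight hβ]
  calc _ ≤ 1 * (|κ| * (2 * (2 * g * q * coherentConst))) +
        √(2 * Real.pi) / β * (4 * g * q * (β * filterConst ^ 2)) := by gcongr
    _ = _ := by
        field_simp
        ring

end JumpEstimates

/-! ### From a continuum of jump operators to finitely many. -/

section FiniteKraus

variable {n : Type*} [Fintype n] [DecidableEq n]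

theorem integrable_of_entry {α : Type*} [MeasurableSpace α] {μ : Measure α} {f : α → Matrix n n ℂ}
    (hf : ∀ i j, Integrable (fun x => f x i j) μ) : Integrable f μ := by
  have e : f = fun x => ∑ i, ∑ j, f x i j • Matrix.single i j (1 : ℂ) := by
    ext1 x
    conv_lhs => rw [Matrix.matrix_eq_sum_single (f x)]
    simp [Matrix.smul_single]
  rw [e]
  exact integrable_finsetSum _ fun i _ => integrable_finsetSum _ fun j _ => (hf i j).smul_const _

theorem linearMap_integral {α : Type*} [MeasurableSpace α] {μ : Measure α} {f : α → Matrix n n ℂ}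
    (hf : Integrable f μ) (ψ : Matrix n n ℂ →ₗ[ℂ] ℂ) : ψ (∫ x, f x ∂μ) = ∫ x, ψ (f x) ∂μ := by
  have hψ : ∀ M : Matrix n n ℂ, ψ M = ∑ i, ∑ j, M i j * ψ (Matrix.single i j 1) := fun M => by
    conv_lhs => rw [Matrix.matrix_eq_sum_single M]
    simp only [map_sum]
    refine Finset.sum_congr rfl fun i _ => Finset.sum_congr rfl fun j _ => ?_
    rw [← smul_eq_mul, ← map_smul, Matrix.smul_single, smul_eq_mul, mul_one]
  have hi := fun i j => (integrable_entry hf i j).mul_const (ψ (Matrix.single i j 1))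
  rw [hψ (∫ x, f x ∂μ), funext fun x => hψ (f x)]
  rw [integral_finsetSum _ fun i _ => integrable_finsetSum _ fun j _ => hi i j]
  refine Finset.sum_congr rfl fun i _ => ?_
  rw [integral_finsetSum _ fun j _ => hi i j]
  refine Finset.sum_congr rfl fun j _ => ?_
  rw [integral_mul_const, integral_entry hf]

/-- The matrix `|L⟩⟨L|` of products of entries of `L`. -/
def outerProduct (L : Matrix n n ℂ) : Matrix (n × n) (n × n) ℂ :=
  Matrix.of fun u v => L u.1 u.2 * star (L v.1 v.2)

/-- The matrix entries of `dissipator L ρ` as linear functionals of `outerProduct L`. -/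
def dissipatorForm (ρ : Matrix n n ℂ) (x y : n) : Matrix (n × n) (n × n) ℂ →ₗ[ℂ] ℂ where
  toFun P := ∑ d, ∑ b, P (x, b) (y, d) * ρ b d -
    (1 / 2) * (∑ b, ∑ a, P (a, b) (a, x) * ρ b y + ∑ b, ∑ a, P (a, y) (a, b) * ρ x b)
  map_add' P Q := by
    simp only [Matrix.add_apply, add_mul, Finset.sum_add_distrib]
    ring
  map_smul' c P := by
    simp only [Matrix.smul_apply, smul_eq_mul, mul_assoc, ← Finset.mul_sum, RingHom.id_apply]
    ring

set_option linter.unusedSectionVars false in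
theorem dissipatorForm_outerProduct (L ρ : Matrix n n ℂ) (x y : n) :
    dissipatorForm ρ x y (outerProduct L) = dissipator L ρ x y := by
  simp only [dissipatorForm, outerProduct, dissipator, LinearMap.coe_mk, AddHom.coe_mk,
    Matrix.of_apply, Matrix.sub_apply, Matrix.smul_apply, Matrix.add_apply, Matrix.mul_apply,
    Matrix.conjTranspose_apply, smul_eq_mul, Finset.sum_mul, Finset.mul_sum]
  congr 1
  · exact Finset.sum_congr rfl fun d _ => Finset.sum_congr rfl fun b _ => by ring
  · congr 2
    · exact Finset.sum_congr rfl fun d _ => Finset.sum_congr rfl fun b _ => by ring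
    · exact Finset.sum_congr rfl fun d _ => Finset.sum_congr rfl fun b _ => by ring

open scoped ComplexOrder in
/-- A positive mixture of rank-one maps `|L⟩⟨L|` with all `L` in a subspace `V` is a finite sum of
such maps. -/
theorem exists_finite_outerProduct_eq_integral (V : Submodule ℂ (Matrix n n ℂ)) {γ : ℝ → ℝ}
    (hγ : ∀ ω, 0 ≤ γ ω) {L : ℝ → Matrix n n ℂ} (hLV : ∀ ω, L ω ∈ V)
    (hint : Integrable fun ω => (γ ω : ℂ) • outerProduct (L ω)) :
    ∃ K : n × n → Matrix n n ℂ, (∀ p, K p ∈ V) ∧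
      ∑ p, outerProduct (K p) = ∫ ω, (γ ω : ℂ) • outerProduct (L ω) := by
  set P := ∫ ω, (γ ω : ℂ) • outerProduct (L ω) with hPdef
  have hPe : ∀ u v, P u v = ∫ ω, (γ ω : ℂ) * (L ω u.1 u.2 * star (L ω v.1 v.2)) := fun u v =>
    integral_entry hint u v
  have hie : ∀ u v : n × n, Integrable fun ω => (γ ω : ℂ) * (L ω u.1 u.2 * star (L ω v.1 v.2)) :=
    fun u v => integrable_entry hint u v
  have hPx : ∀ (x : n × n → ℂ) (u : n × n), (P.mulVec x) u =
      ∫ ω, (γ ω : ℂ) * (L ω u.1 u.2 * ∑ v, star (L ω v.1 v.2) * x v) := fun x u => by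
    simp only [Matrix.mulVec, dotProduct, hPe, ← integral_mul_const]
    rw [← integral_finsetSum _ fun v _ => (hie u v).mul_const _]
    congr 1
    ext1 ω
    simp only [Finset.mul_sum]
    exact Finset.sum_congr rfl fun v _ => by ring
  have hix : ∀ (x : n × n → ℂ) (u : n × n), Integrable fun ω =>
      (γ ω : ℂ) * (L ω u.1 u.2 * ∑ v, star (L ω v.1 v.2) * x v) := fun x u => by
    have h := integrable_finsetSum Finset.univ fun v _ => (hie u v).mul_const (x v)
    refine h.congr (Filter.Eventually.of_forall fun ω => ?_)
    simp only [Finset.mul_sum]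
    exact Finset.sum_congr rfl fun v _ => by ring
  have hH : P.IsHermitian := by
    rw [Matrix.IsHermitian, hPdef, conjTranspose_integral]
    congr 1
    ext1 ω
    ext u v
    simp [outerProduct, mul_comm]
  have hpos : P.PosSemidef := by
    refine Matrix.PosSemidef.of_dotProduct_mulVec_nonneg hH fun x => ?_
    have e : star x ⬝ᵥ P.mulVec x =
        ((∫ ω, γ ω * Complex.normSq (∑ v, star (L ω v.1 v.2) * x v) : ℝ) : ℂ) := by
      simp only [dotProduct, hPx, ← integral_const_mul]
      rw [← integral_finsetSum _ fun u _ => (hix x u).const_mul _, ← integral_complex_ofReal]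
      congr 1
      ext1 ω
      rw [Complex.ofReal_mul, ← Complex.mul_conj, map_sum, mul_comm (∑ v, _) (∑ v, _),
        Finset.sum_mul, Finset.mul_sum]
      refine Finset.sum_congr rfl fun u _ => ?_
      simp only [Pi.star_apply, Complex.star_def, map_mul, Complex.conj_conj]
      ring
    rw [e, Complex.zero_le_real]
    exact integral_nonneg fun ω => mul_nonneg (hγ ω) (Complex.normSq_nonneg _)
  obtain ⟨W, hW, hW', hP⟩ := exists_unitary_diagonalization hH
  set ev := hH.eigenvalues
  have hev : ∀ p, 0 ≤ ev p := hpos.eigenvalues_nonneg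
  -- The new operators are the eigenvectors of `P` scaled by the root of the eigenvalue. A null
  -- eigenvector need not lie in `V` but gets coefficient zero; any other is `P` applied to itself
  -- divided by the eigenvalue, hence an integral of multiples of the `L ω`.
  refine ⟨fun p => (√(ev p) : ℂ) • Matrix.of fun i j => W (i, j) p, fun p => ?_, ?_⟩
  · by_cases h0 : ev p = 0
    · simp [h0]
    refine V.smul_mem _ ?_
    have hcol : P.mulVec (fun u => W u p) = fun u => (ev p : ℂ) * W u p := by
      have h1 : P * W = W * Matrix.diagonal fun i => (ev i : ℂ) := by
        rw [hP, mul_assoc, hW, mul_one]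
      ext u
      have h2 := congrFun (congrFun h1 u) p
      rw [Matrix.mul_diagonal, Matrix.mul_apply] at h2
      rw [Matrix.mulVec, dotProduct, h2, mul_comm]
    have hf : Integrable fun ω =>
        ((γ ω : ℂ) * ∑ v, star (L ω v.1 v.2) * W v p) • L ω :=
      integrable_of_entry fun i j => (hix (fun u => W u p) (i, j)).congr
        (Filter.Eventually.of_forall fun ω => by
          simp only [Matrix.smul_apply, smul_eq_mul]; ring)
    have hmem : (∫ ω, ((γ ω : ℂ) * ∑ v, star (L ω v.1 v.2) * W v p) • L ω) ∈ V :=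
      integral_mem_submodule V fun ω => V.smul_mem _ (hLV ω)
    have e : (Matrix.of fun i j => W (i, j) p) = ((ev p : ℂ)⁻¹) •
        ∫ ω, ((γ ω : ℂ) * ∑ v, star (L ω v.1 v.2) * W v p) • L ω := by
      ext i j
      have h3 := congrFun hcol (i, j)
      rw [hPx] at h3
      rw [Matrix.smul_apply, integral_entry hf, Matrix.of_apply, smul_eq_mul,
        eq_inv_mul_iff_mul_eq₀ (by exact_mod_cast h0), ← h3]
      congr 1
      ext1 ω
      simp only [Matrix.smul_apply, smul_eq_mul]
      ring
    rw [e]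
    exact V.smul_mem _ hmem
  · rw [hP]
    ext u v
    rw [Matrix.sum_apply, Matrix.mul_apply]
    refine Finset.sum_congr rfl fun p _ => ?_
    have hsq : ((√(ev p) : ℝ) : ℂ) * ((√(ev p) : ℝ) : ℂ) = ev p := by
      rw [← Complex.ofReal_mul, Real.mul_self_sqrt (hev p)]
    rw [Matrix.mul_diagonal, Matrix.conjTranspose_apply]
    simp only [outerProduct, Matrix.of_apply, Matrix.smul_apply, smul_eq_mul, star_mul',
      Complex.star_def, Complex.conj_ofReal]
    linear_combination W u p * (starRingEnd ℂ) (W v p) * hsq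

/-- The dissipator depends on `L` only through `outerProduct L`, and linearly so. One decomposition
of the averaged outer product therefore works for every `ρ`. -/
theorem exists_finite_dissipator_eq_integral (V : Submodule ℂ (Matrix n n ℂ)) {γ : ℝ → ℝ}
    (hγ0 : ∀ ω, 0 ≤ γ ω) (hγ : Continuous γ) (hγi : Integrable γ) {L : ℝ → Matrix n n ℂ}
    (hL : Continuous L) {b : ℝ} (hb : ∀ ω, ‖L ω‖ ≤ b) (hLV : ∀ ω, L ω ∈ V) :
    ∃ K : n × n → Matrix n n ℂ, (∀ p, K p ∈ V) ∧ ∀ ρ,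
      ∑ p, dissipator (K p) ρ = ∫ ω, (γ ω : ℂ) • dissipator (L ω) ρ := by
  have hent : ∀ i j, Continuous fun ω => L ω i j := fun i j => (entryCLM i j).continuous.comp hL
  have hbe : ∀ i j ω, ‖L ω i j‖ ≤ ‖entryCLM (n := n) i j‖ * b := fun i j ω =>
    ((entryCLM i j).le_opNorm (L ω)).trans (mul_le_mul_of_nonneg_left (hb ω) (norm_nonneg _))
  have hint : Integrable fun ω => (γ ω : ℂ) • outerProduct (L ω) := by
    refine integrable_of_entry fun u v => ?_
    have h1 := hent u.1 u.2
    have h2 := (hent v.1 v.2).star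
    refine (hγi.norm.mul_const ((‖entryCLM (n := n) u.1 u.2‖ * b) *
      (‖entryCLM (n := n) v.1 v.2‖ * b))).mono'
      (Continuous.aestronglyMeasurable ?_) (Filter.Eventually.of_forall fun ω => ?_)
    · exact (Complex.continuous_ofReal.comp hγ).mul (h1.mul h2)
    · simp only [Matrix.smul_apply, outerProduct, Matrix.of_apply, norm_smul, norm_mul, norm_star,
        Complex.norm_real]
      refine mul_le_mul_of_nonneg_left ?_ (norm_nonneg _)
      exact mul_le_mul (hbe _ _ _) (hbe _ _ _) (norm_nonneg _) ((norm_nonneg _).trans (hbe _ _ ω))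
  obtain ⟨K, hKV, hK⟩ := exists_finite_outerProduct_eq_integral V hγ0 hLV hint
  refine ⟨K, hKV, fun ρ => ?_⟩
  ext x y
  rw [Matrix.sum_apply, integral_entry (integrable_weighted_dissipator hγ hγi hL hb ρ)]
  simp only [← dissipatorForm_outerProduct, Matrix.smul_apply]
  rw [← map_sum, hK, linearMap_integral hint]
  simp only [map_smul]

end FiniteKraus

/-! ### First-order channels for a Lindbladian. -/

section Channel

variable {n : Type*} [Fintype n] [DecidableEq n]

set_option linter.unusedSectionVars false in
theorem isSelfAdjoint_sum_conjTranspose_mul_self {ι : Type*} (s : Finset ι)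
    (L : ι → Matrix n n ℂ) : IsSelfAdjoint (∑ i ∈ s, (L i)ᴴ * L i) :=
  isHermitian_sum s fun i => Matrix.isHermitian_conjTranspose_mul_self (L i)

/-- With `s = √(1 - y)` the remainder is exactly `-(s - 1)² / 2`, and `y = (1 - s)(1 + s)` with `1 +
s ≥ 1`. -/
theorem abs_sqrt_one_sub_sub_le {y : ℝ} (hy : |y| ≤ 1) : |√(1 - y) - 1 + y / 2| ≤ y ^ 2 := by
  have h1 : 0 ≤ 1 - y := by linarith [(abs_le.1 hy).2]
  have hs := Real.sqrt_nonneg (1 - y)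
  have hsq := Real.sq_sqrt h1
  set s := √(1 - y)
  have e : s - 1 + y / 2 = -((s - 1) ^ 2 / 2) := by linear_combination (1 / 2) * hsq
  have hy' : y = (1 - s) * (1 + s) := by linear_combination hsq
  rw [e, abs_neg, abs_of_nonneg (by positivity), hy']
  nlinarith [sq_nonneg (s - 1), mul_nonneg (sq_nonneg (s - 1)) hs,
    mul_nonneg (sq_nonneg (s - 1)) (sq_nonneg s)]

/-- The square root of `1 - δ D`. -/
def sqrtOneSub (D : Matrix n n ℂ) (δ : ℝ) : Matrix n n ℂ := cfc (fun x : ℝ => √(1 - δ * x)) D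

theorem sqrtOneSub_conjTranspose (D : Matrix n n ℂ) (δ : ℝ) :
    (sqrtOneSub D δ)ᴴ = sqrtOneSub D δ :=
  (cfc_predicate (R := ℝ) (fun x : ℝ => √(1 - δ * x)) D : IsSelfAdjoint _)

theorem abs_le_norm_of_mem_spectrum {D : Matrix n n ℂ} {x : ℝ} (hx : x ∈ spectrum ℝ D) :
    |x| ≤ ‖D‖ := by
  have h := spectrum.norm_le_norm_mul_of_mem hx
  exact h.trans (mul_le_of_le_one_right (norm_nonneg _) norm_one_le)

theorem sqrtOneSub_mul_self {D : Matrix n n ℂ} (hD : IsSelfAdjoint D) {δ : ℝ}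
    (hδ : |δ| * ‖D‖ ≤ 1) : sqrtOneSub D δ * sqrtOneSub D δ = 1 - (δ : ℂ) • D := by
  unfold sqrtOneSub
  rw [← cfc_mul _ _ D (by fun_prop) (by fun_prop)]
  have e : (spectrum ℝ D).EqOn (fun x : ℝ => √(1 - δ * x) * √(1 - δ * x))
      (fun x => 1 - δ * x) := fun x hx => by
    have h1 := mul_le_mul_of_nonneg_left (abs_le_norm_of_mem_spectrum hx) (abs_nonneg δ)
    rw [← abs_mul] at h1
    exact Real.mul_self_sqrt (by linarith [le_abs_self (δ * x)])
  rw [cfc_congr e, cfc_sub (fun _ => (1 : ℝ)) (fun x => δ * x) D (by fun_prop) (by fun_prop),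
    cfc_const_one ℝ D, cfc_const_mul_id δ D]
  rfl

theorem norm_sqrtOneSub_sub_le {D : Matrix n n ℂ} (hD : IsSelfAdjoint D) {δ : ℝ}
    (hδ : |δ| * ‖D‖ ≤ 1) :
    ‖sqrtOneSub D δ - 1 + (δ : ℂ) • ((1 / 2 : ℂ) • D)‖ ≤ δ ^ 2 * ‖D‖ ^ 2 := by
  have e : sqrtOneSub D δ - 1 + (δ : ℂ) • ((1 / 2 : ℂ) • D) =
      cfc (fun x : ℝ => √(1 - δ * x) - 1 + δ * x / 2) D := by
    have e1 : (δ : ℂ) • ((1 / 2 : ℂ) • D) = cfc (fun x : ℝ => δ * x / 2) D := by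
      have : (fun x : ℝ => δ * x / 2) = fun x => (δ / 2) * x := by ext; ring
      rw [this, cfc_const_mul_id (δ / 2) D, smul_smul]
      have : ((δ : ℂ) * (1 / 2)) = ((δ / 2 : ℝ) : ℂ) := by push_cast; ring
      rw [this]
      rfl
    rw [e1, ← cfc_const_one ℝ D, sqrtOneSub,
      ← cfc_sub _ (fun _ => (1 : ℝ)) D (by fun_prop) (by fun_prop),
      ← cfc_add (fun x : ℝ => √(1 - δ * x) - 1) _ (a := D) (by fun_prop) (by fun_prop)]
  rw [e]
  refine norm_cfc_le (by positivity) fun x hx => ?_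
  have hxD := abs_le_norm_of_mem_spectrum hx
  have h1 := mul_le_mul_of_nonneg_left hxD (abs_nonneg δ)
  rw [← abs_mul] at h1
  refine (abs_sqrt_one_sub_sub_le (h1.trans hδ)).trans ?_
  rw [mul_pow]
  exact mul_le_mul_of_nonneg_left (sq_le_sq' (abs_le.1 hxD).1 (abs_le.1 hxD).2) (sq_nonneg δ)

theorem hasDerivAt_sqrtOneSub {D : Matrix n n ℂ} (hD : IsSelfAdjoint D) :
    HasDerivAt (sqrtOneSub D) (-((1 / 2 : ℂ) • D)) 0 := by
  have h0 : sqrtOneSub D 0 = 1 := by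
    simp only [sqrtOneSub, zero_mul, sub_zero, Real.sqrt_one]
    exact cfc_const_one ℝ D
  rw [hasDerivAt_iff_isLittleO_nhds_zero]
  have hO : (fun δ : ℝ => sqrtOneSub D (0 + δ) - sqrtOneSub D 0 - δ • -((1 / 2 : ℂ) • D))
      =O[nhds 0] fun δ : ℝ => δ ^ 2 := by
    refine Asymptotics.IsBigO.of_bound (‖D‖ ^ 2) ?_
    have hev : ∀ᶠ δ : ℝ in nhds 0, |δ| * ‖D‖ < 1 := by
      have hc : Continuous fun δ : ℝ => |δ| * ‖D‖ := by fun_prop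
      exact hc.continuousAt.eventually_lt continuousAt_const (by simp)
    filter_upwards [hev] with δ hδ
    have h := norm_sqrtOneSub_sub_le hD hδ.le
    rw [h0, zero_add, smul_neg, sub_neg_eq_add, Real.norm_of_nonneg (sq_nonneg δ),
      mul_comm (‖D‖ ^ 2)]
    exact h
  refine hO.trans_isLittleO ?_
  simpa using (Asymptotics.isLittleO_pow_pow (𝕜 := ℝ) (m := 1) (n := 2) one_lt_two)

/-- The Kraus operator `exp(-iδB) √(1 - δD)` of the no-jump evolution. -/
def noJump (B D : Matrix n n ℂ) (δ : ℝ) : Matrix n n ℂ := propagator B (-δ) * sqrtOneSub D δ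

theorem noJump_conjTranspose_mul_self {B D : Matrix n n ℂ} (hB : B.IsHermitian)
    (hD : IsSelfAdjoint D) {δ : ℝ} (hδ : |δ| * ‖D‖ ≤ 1) :
    (noJump B D δ)ᴴ * noJump B D δ = 1 - (δ : ℂ) • D := by
  unfold noJump
  rw [Matrix.conjTranspose_mul, propagator_conjTranspose hB, neg_neg, sqrtOneSub_conjTranspose]
  calc _ = sqrtOneSub D δ * (propagator B δ * propagator B (-δ)) * sqrtOneSub D δ := by
        simp only [mul_assoc]
    _ = _ := by rw [propagator_mul_neg, mul_one, sqrtOneSub_mul_self hD hδ]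

theorem hasDerivAt_noJump (B : Matrix n n ℂ) {D : Matrix n n ℂ} (hD : IsSelfAdjoint D) :
    HasDerivAt (noJump B D) (-(Complex.I • B) - (1 / 2 : ℂ) • D) 0 := by
  have h1 : HasDerivAt (fun s => propagator B (-s)) (-(Complex.I • B)) 0 := by
    have h := (hasDerivAt_propagator B (-0)).scomp (0 : ℝ) (hasDerivAt_neg 0)
    rw [neg_one_smul, neg_zero, propagator_zero, one_mul] at h
    exact h
  refine HasDerivAt.congr_deriv (h1.mul (hasDerivAt_sqrtOneSub hD)) ?_
  have h0 : sqrtOneSub D 0 = 1 := by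
    simp only [sqrtOneSub, zero_mul, sub_zero, Real.sqrt_one]
    exact cfc_const_one ℝ D
  rw [h0, neg_zero, propagator_zero, mul_one, one_mul, sub_eq_add_neg]

/-- Conjugation by `1 + δQ` differs from its linear part only by `δ² QρQ†`. Replacing `K` by `1 +
δQ` costs two terms, each with one factor of size `cδ` and one of norm at most `2`. -/
theorem diamondBound_conj_sub_first_order {K Q : Matrix n n ℂ} {δ c : ℝ} (hδ : 0 ≤ δ)
    (hK : ‖K‖ ≤ 2) (hY : ‖K - (1 + (δ : ℂ) • Q)‖ ≤ c * δ) (hQ : δ * ‖Q‖ ≤ 1) :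
    DiamondBound (fun ρ => ρ + (δ : ℂ) • (Q * ρ + ρ * Qᴴ) - K * ρ * Kᴴ)
      ((4 * c + δ * ‖Q‖ ^ 2) * δ) := by
  set Y := K - (1 + (δ : ℂ) • Q) with hYdef
  have e : (fun ρ => ρ + (δ : ℂ) • (Q * ρ + ρ * Qᴴ) - K * ρ * Kᴴ) = fun ρ =>
      (-1 : ℂ) • (Y * ρ * Kᴴ + (1 + (δ : ℂ) • Q) * ρ * Yᴴ + (δ : ℂ) ^ 2 • (Q * ρ * Qᴴ)) := by
    ext1 ρ
    have hKe : K = Y + (1 + (δ : ℂ) • Q) := by rw [hYdef]; abel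
    have hYH : Yᴴ = Kᴴ - (1 + (δ : ℂ) • Qᴴ) := by
      rw [hYdef, Matrix.conjTranspose_sub, Matrix.conjTranspose_add, Matrix.conjTranspose_one,
        Matrix.conjTranspose_smul, Complex.star_def, Complex.conj_ofReal]
    have h1 : Y * ρ * Kᴴ = K * ρ * Kᴴ - (1 + (δ : ℂ) • Q) * ρ * Kᴴ := by
      rw [hYdef, sub_mul, sub_mul]
    rw [h1, hYH]
    simp only [add_mul, mul_add, mul_sub, one_mul, mul_one, smul_mul_assoc, mul_smul_comm,
      smul_add, smul_sub, smul_smul, neg_one_smul, ← sq]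
    abel_nf
    simp
    abel
  rw [e]
  have hQn : ‖(1 + (δ : ℂ) • Q)‖ ≤ 2 := by
    refine (norm_add_le _ _).trans ?_
    rw [norm_smul, Complex.norm_real, Real.norm_of_nonneg hδ]
    linarith [norm_one_le (n := n)]
  refine ((((diamondBound_sandwich Y Kᴴ).add
    (diamondBound_sandwich (1 + (δ : ℂ) • Q) Yᴴ)).add
      ((diamondBound_sandwich Q Qᴴ).smul ((δ : ℂ) ^ 2))).smul (-1)).mono ?_
  rw [norm_neg, norm_one, one_mul, Matrix.l2_opNorm_conjTranspose, Matrix.l2_opNorm_conjTranspose,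
    Matrix.l2_opNorm_conjTranspose, norm_pow, Complex.norm_real, Real.norm_of_nonneg hδ]
  have hcd : 0 ≤ c * δ := (norm_nonneg _).trans hY
  calc _ ≤ c * δ * 2 + 2 * (c * δ) + δ ^ 2 * (‖Q‖ * ‖Q‖) := by gcongr
    _ = _ := by ring

/-- A Lindbladian generates, to first order in `δ`, a quantum channel with Kraus operators
`noJump` and `√δ L i`. -/
theorem exists_noJump_channel {ι : Type*} [Fintype ι] {B : Matrix n n ℂ} (hB : B.IsHermitian)
    (L : ι → Matrix n n ℂ) {τ : ℝ} (hτ : 0 < τ) :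
    ∃ δ₀ : ℝ, 0 < δ₀ ∧ ∀ δ : ℝ, 0 < δ → δ ≤ δ₀ →
      (noJump B (∑ i, (L i)ᴴ * L i) δ)ᴴ * noJump B (∑ i, (L i)ᴴ * L i) δ =
        1 - (δ : ℂ) • ∑ i, (L i)ᴴ * L i ∧
      DiamondBound (fun ρ =>
        ρ + (δ : ℂ) • (-Complex.I • (B * ρ - ρ * B) + ∑ i, dissipator (L i) ρ) -
          (noJump B (∑ i, (L i)ᴴ * L i) δ * ρ * (noJump B (∑ i, (L i)ᴴ * L i) δ)ᴴ +
            (δ : ℂ) • ∑ i, L i * ρ * (L i)ᴴ)) (τ * δ) := by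
  set D := ∑ i, (L i)ᴴ * L i with hDdef
  have hD : IsSelfAdjoint D := isSelfAdjoint_sum_conjTranspose_mul_self _ L
  set Q := -(Complex.I • B) - (1 / 2 : ℂ) • D with hQ
  have h0 : noJump B D 0 = 1 := by
    simp only [noJump, sqrtOneSub, neg_zero, propagator_zero, zero_mul, sub_zero, Real.sqrt_one,
      one_mul]
    exact cfc_const_one ℝ D
  have hder := (hasDerivAt_iff_isLittleO_nhds_zero.1 (hasDerivAt_noJump B hD)).bound
    (show 0 < τ / 8 by positivity)
  obtain ⟨d, hd, hball⟩ := Metric.eventually_nhds_iff.1 hder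
  -- In order, these ensure the derivative estimate with slope `τ/8`, the identity `√(1 - δD)² = 1 -
  -- δD`, `δ‖Q‖ ≤ 1`, and `δ‖Q‖² ≤ τ/2`. With `c = τ/8` the total error is then at most `τδ`.
  refine ⟨min (d / 2) (min (1 / (‖D‖ + 1)) (min (1 / (‖Q‖ + 1)) (τ / (2 * (‖Q‖ ^ 2 + 1))))),
    by positivity, fun δ hδ hle => ?_⟩
  have hδd : δ ≤ d / 2 := hle.trans (min_le_left _ _)
  have hle2 := hle.trans (min_le_right _ _)
  have hδD : δ ≤ 1 / (‖D‖ + 1) := hle2.trans (min_le_left _ _)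
  have hle3 := hle2.trans (min_le_right _ _)
  have hδQ : δ ≤ 1 / (‖Q‖ + 1) := hle3.trans (min_le_left _ _)
  have hδτ : δ ≤ τ / (2 * (‖Q‖ ^ 2 + 1)) := hle3.trans (min_le_right _ _)
  rw [le_div_iff₀ (by positivity)] at hδD hδQ hδτ
  have hDδ : |δ| * ‖D‖ ≤ 1 := by rw [abs_of_pos hδ]; linarith
  have hKK := noJump_conjTranspose_mul_self hB hD hDδ
  refine ⟨hKK, ?_⟩
  have hY : ‖noJump B D δ - (1 + (δ : ℂ) • Q)‖ ≤ τ / 8 * δ := by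
    have h := hball (y := δ) (by rw [dist_zero_right, Real.norm_of_nonneg hδ.le]; linarith)
    rw [zero_add, h0, Real.norm_of_nonneg hδ.le, sub_sub] at h
    exact h
  have hK : ‖noJump B D δ‖ ≤ 2 := by
    have h : ‖noJump B D δ‖ * ‖noJump B D δ‖ ≤ 1 + δ * ‖D‖ := by
      rw [← Matrix.l2_opNorm_conjTranspose_mul_self, hKK]
      refine (norm_sub_le _ _).trans (add_le_add norm_one_le ?_)
      rw [norm_smul, Complex.norm_real, Real.norm_of_nonneg hδ.le]
    nlinarith [norm_nonneg (noJump B D δ)]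
  have hmain := diamondBound_conj_sub_first_order hδ.le hK hY (by linarith)
  have e : (fun ρ => ρ + (δ : ℂ) • (-Complex.I • (B * ρ - ρ * B) + ∑ i, dissipator (L i) ρ) -
      (noJump B D δ * ρ * (noJump B D δ)ᴴ + (δ : ℂ) • ∑ i, L i * ρ * (L i)ᴴ)) = fun ρ =>
      ρ + (δ : ℂ) • (Q * ρ + ρ * Qᴴ) - noJump B D δ * ρ * (noJump B D δ)ᴴ := by
    ext1 ρ
    have hQH : Qᴴ = Complex.I • B - (1 / 2 : ℂ) • D := by
      have hDH : Dᴴ = D := hD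
      rw [hQ, Matrix.conjTranspose_sub, Matrix.conjTranspose_neg, Matrix.conjTranspose_smul,
        Matrix.conjTranspose_smul, hB.eq, hDH]
      simp
    have hdis : ∑ i, dissipator (L i) ρ =
        ∑ i, L i * ρ * (L i)ᴴ - (1 / 2 : ℂ) • (D * ρ + ρ * D) := by
      simp only [dissipator, Finset.sum_sub_distrib, ← Finset.smul_sum, Finset.sum_add_distrib,
        hDdef, Finset.sum_mul, Finset.mul_sum]
    rw [hdis, hQH, hQ]
    simp only [sub_mul, mul_sub, neg_mul, smul_mul_assoc, mul_smul_comm, smul_add, smul_sub,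
      neg_smul, smul_neg]
    abel
  rw [e]
  refine hmain.mono (mul_le_mul_of_nonneg_right ?_ hδ.le)
  nlinarith [norm_nonneg Q]

end Channel

/-! ### Assembling local Lindbladians and channels. -/

section Assembly

variable {r : ℕ} {Λ : Finset (Fin r → ℤ)}

theorem noJump_mem_localOps {S : Set Λ} {B D : Op Λ} (hB : B ∈ localOps S) (hD : D ∈ localOps S)
    (δ : ℝ) : noJump B D δ ∈ localOps S := by
  have : IsClosed (localOps S : Set (Op Λ)) := isClosed_localOps S
  exact mul_mem (exp_mem_localOps (SMulMemClass.smul_mem _ hB)) (cfc_mem (𝕜' := ℂ) _ hD)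

theorem exists_local_chenTerm_eq {S : Set Λ} {H A : Op Λ} (κ : ℝ) (hH : H.IsHermitian)
    (hHS : H ∈ localOps S) (hAS : A ∈ localOps S) {β : ℝ} (hβ : 0 < β) :
    ∃ (B : Op Λ) (L : Config Λ × Config Λ → Op Λ), B.IsHermitian ∧ B ∈ localOps S ∧
      (∀ p, L p ∈ localOps S) ∧ ∀ ρ, chenTerm κ H β A ρ =
        -Complex.I • (B * ρ - ρ * B) + ∑ p, dissipator (L p) ρ := by
  obtain ⟨L, hL, hLe⟩ := exists_finite_dissipator_eq_integral
    (Subalgebra.toSubmodule (localOps S).toSubalgebra) (fun ω => (Real.exp_pos _).le)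
    (continuous_transWeight β) (integrable_transWeight hβ.ne')
    (continuous_jumpFourier (A := A) hH hβ) (fun ω => norm_jumpFourier_le hH hβ le_rfl ω)
    fun ω => jumpFourier_mem_localOps hHS hAS β ω
  refine ⟨(κ : ℂ) • coherentTerm H β A, L, ?_,
    SMulMemClass.smul_mem _ (coherentTerm_mem_localOps hHS hAS β), hL, fun ρ => ?_⟩
  · rw [Matrix.IsHermitian, Matrix.conjTranspose_smul, (coherentTerm_isHermitian hH β A).eq,
      Complex.star_def, Complex.conj_ofReal]
  · rw [hLe, chenTerm, smul_mul_assoc, mul_smul_comm, smul_sub]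
    rfl

/-- Sums of superoperators that are each close to a local Lindbladian are close to a local
Lindbladian and generate, to first order, a channel with local Kraus operators. -/
theorem exists_lindbladian_and_channel {ι : Type} [Fintype ι] {J : ℕ} (hJ : 0 < J)
    {S : Fin J → Set Λ} {B : Fin J → Op Λ} {L : Fin J → ι → Op Λ} (hB : ∀ a, (B a).IsHermitian)
    (hBS : ∀ a, B a ∈ localOps (S a)) (hLS : ∀ a p, L a p ∈ localOps (S a))
    {Φ : Fin J → Op Λ → Op Λ} {ε : ℝ} (hε : 0 < ε)
    (hΦ : ∀ a, DiamondBound (fun ρ =>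
      Φ a ρ - (-Complex.I • (B a * ρ - ρ * B a) + ∑ p, dissipator (L a p) ρ)) (ε / (2 * J))) :
    ∃ (p q : ℕ) (B : Fin p → Op Λ) (L : Fin q → Op Λ),
      (∀ j, (B j).IsHermitian) ∧ (∀ j, ∃ a, ActsOn (B j) (S a)) ∧ (∀ i, ∃ a, ActsOn (L i) (S a)) ∧
      diamondNorm (fun ρ => ∑ a, Φ a ρ - lindbladian B L ρ) ≤ ENNReal.ofReal ε ∧
      ∃ δ₀ : ℝ, 0 < δ₀ ∧ ∀ δ : ℝ, 0 < δ → δ ≤ δ₀ → ∃ (m : ℕ) (K : Fin m → Op Λ),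
        ∑ i, (K i).conjTranspose * K i = 1 ∧ (∀ i, ∃ a, ActsOn (K i) (S a)) ∧
        diamondNorm (fun ρ => ρ + (δ : ℂ) • ∑ a, Φ a ρ - krausMap K ρ) ≤
          ENNReal.ofReal (δ * ε) := by
  have hJ' : (0 : ℝ) < J := by exact_mod_cast hJ
  have hJc : (J : ℂ) ≠ 0 := by exact_mod_cast hJ.ne'
  set T : Fin J → Op Λ → Op Λ := fun a ρ =>
    -Complex.I • (B a * ρ - ρ * B a) + ∑ p, dissipator (L a p) ρ with hT
  have hsum : DiamondBound (fun ρ => ∑ a, (Φ a ρ - T a ρ)) (ε / 2) := by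
    refine (DiamondBound.sum Finset.univ hΦ).mono (le_of_eq ?_)
    rw [Finset.sum_const, Finset.card_univ, Fintype.card_fin, nsmul_eq_mul]
    field_simp
  let e := Fintype.equivFin (Fin J × ι)
  refine ⟨J, Fintype.card (Fin J × ι), B, fun i => L (e.symm i).1 (e.symm i).2, hB,
    fun j => ⟨j, hBS j⟩, fun i => ⟨_, hLS _ _⟩, ?_, ?_⟩
  · refine (DiamondBound.diamondNorm_le (c := ε) ?_ hε.le)
    have heq : (fun ρ => ∑ a, Φ a ρ - lindbladian B (fun i => L (e.symm i).1 (e.symm i).2) ρ) =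
        fun ρ => ∑ a, (Φ a ρ - T a ρ) := by
      ext1 ρ
      rw [Finset.sum_sub_distrib]
      congr 1
      rw [lindbladian, Equiv.sum_comp e.symm fun u : Fin J × ι => dissipator (L u.1 u.2) ρ,
        Fintype.sum_prod_type]
      simp only [hT, Finset.sum_add_distrib, ← Finset.smul_sum, Finset.sum_sub_distrib,
        Finset.sum_mul, Finset.mul_sum]
    rw [heq]
    exact hsum.mono (by linarith)
  · have hτ : 0 < ε / (2 * J) := by positivity
    choose d hd hch using fun a => exists_noJump_channel (hB a) (L a) hτ
    have hne : (Finset.univ : Finset (Fin J)).Nonempty := ⟨⟨0, hJ⟩, Finset.mem_univ _⟩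
    -- Channel `a` is run with probability `1/J` for the longer step `δJ`, so `δJ` must stay below
    -- every threshold `d a`.
    refine ⟨Finset.univ.inf' hne d / J, ?_, fun δ hδ hle => ?_⟩
    · exact div_pos ((Finset.lt_inf'_iff hne).2 fun a _ => hd a) hJ'
    rw [le_div_iff₀ hJ'] at hle
    have hδa : ∀ a, δ * J ≤ d a := fun a => hle.trans (Finset.inf'_le _ (Finset.mem_univ a))
    have hδJ : 0 < δ * J := by positivity
    have hc := fun a => hch a (δ * J) hδJ (hδa a)
    let N : Fin J → Op Λ := fun a => noJump (B a) (∑ p, (L a p)ᴴ * L a p) (δ * J)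
    -- `none` labels the no-jump operator. In the jump operators the probability `1/J` and the step
    -- `δJ` combine to `√δ`.
    let K : Fin J × Option ι → Op Λ := fun u =>
      u.2.elim ((√(1 / J) : ℂ) • N u.1) fun p => (√δ : ℂ) • L u.1 p
    have hsqJ : ((√(1 / J) : ℝ) : ℂ) * ((√(1 / J) : ℝ) : ℂ) = 1 / J := by
      rw [← Complex.ofReal_mul, Real.mul_self_sqrt (by positivity)]
      push_cast
      rfl
    have hsqδ : ((√δ : ℝ) : ℂ) * ((√δ : ℝ) : ℂ) = δ := by
      rw [← Complex.ofReal_mul, Real.mul_self_sqrt hδ.le]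
    let e' := Fintype.equivFin (Fin J × Option ι)
    have hKS : ∀ u, K u ∈ localOps (S u.1) := by
      rintro ⟨a, _ | p⟩
      · exact SMulMemClass.smul_mem _ (noJump_mem_localOps (hBS a)
          (sum_mem fun p _ => mul_mem (star_mem (hLS a p)) (hLS a p)) _)
      · exact SMulMemClass.smul_mem _ (hLS a p)
    refine ⟨Fintype.card (Fin J × Option ι), fun i => K (e'.symm i), ?_,
      fun i => ⟨(e'.symm i).1, hKS _⟩, ?_⟩
    · rw [Equiv.sum_comp e'.symm fun u => (K u)ᴴ * K u, Fintype.sum_prod_type]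
      have hK : ∀ a, ∑ o, (K (a, o))ᴴ * K (a, o) = (1 / J : ℂ) • (1 : Op Λ) := fun a => by
        rw [Fintype.sum_option]
        simp only [K, Option.elim, Matrix.conjTranspose_smul, smul_mul_assoc, mul_smul_comm,
          smul_smul, Complex.star_def, Complex.conj_ofReal, hsqJ, hsqδ, ← Finset.smul_sum]
        rw [(hc a).1, smul_sub, smul_smul]
        push_cast
        rw [show (1 / (J : ℂ) * (δ * J)) = δ by field_simp]
        abel
      simp only [hK]
      rw [Finset.sum_const, Finset.card_univ, Fintype.card_fin, ← Nat.cast_smul_eq_nsmul ℂ,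
        smul_smul, mul_one_div_cancel hJc, one_smul]
    · refine (DiamondBound.diamondNorm_le (c := δ * ε) ?_ (by positivity))
      have h1 := hsum.smul (δ : ℂ)
      have h2 := (DiamondBound.sum Finset.univ fun a => (hc a).2).smul (1 / J : ℂ)
      have heq : (fun ρ => ρ + (δ : ℂ) • ∑ a, Φ a ρ - krausMap (fun i => K (e'.symm i)) ρ) =
          fun ρ => (δ : ℂ) • (∑ a, (Φ a ρ - T a ρ)) + (1 / J : ℂ) •
            ∑ a, (ρ + ((δ * J : ℝ) : ℂ) • T a ρ - (N a * ρ * (N a)ᴴ +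
              ((δ * J : ℝ) : ℂ) • ∑ p, L a p * ρ * (L a p)ᴴ)) := by
        ext1 ρ
        have hkr : krausMap (fun i => K (e'.symm i)) ρ =
            ∑ a, ((1 / J : ℂ) • (N a * ρ * (N a)ᴴ) + (δ : ℂ) • ∑ p, L a p * ρ * (L a p)ᴴ) := by
          rw [krausMap, Equiv.sum_comp e'.symm fun u => K u * ρ * (K u)ᴴ, Fintype.sum_prod_type]
          refine Finset.sum_congr rfl fun a _ => ?_
          rw [Fintype.sum_option]
          simp only [K, Option.elim, Matrix.conjTranspose_smul, smul_mul_assoc, mul_smul_comm,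
            smul_smul, Complex.star_def, Complex.conj_ofReal, hsqJ, hsqδ, ← Finset.smul_sum]
        rw [hkr]
        simp only [Finset.sum_sub_distrib, Finset.sum_add_distrib, ← Finset.smul_sum, smul_sub,
          smul_add, smul_smul]
        push_cast
        rw [Finset.sum_const, Finset.card_univ, Fintype.card_fin, ← Nat.cast_smul_eq_nsmul ℂ,
          smul_smul, one_div_mul_cancel hJc, one_smul,
          show (1 / (J : ℂ) * (δ * J)) = δ by field_simp]
        abel
      rw [heq]
      refine (h1.add h2).mono (le_of_eq ?_)
      rw [Finset.sum_const, Finset.card_univ, Fintype.card_fin, nsmul_eq_mul, Complex.norm_real,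
        Real.norm_of_nonneg hδ.le, norm_div, norm_one, Complex.norm_natCast]
      field_simp
      ring

end Assembly

/-! ### Calibration of the radius and conclusion. -/

/-- The `1` in the exponent yields `1/x`; the `4M` absorbs the prefactor, since `log x ≥ 1/2` gives
`exp (4M log x) ≥ 2M`. -/
theorem exp_neg_mul_log_le {M x : ℝ} (hM : 0 ≤ M) (hx : 2 ≤ x) :
    M * Real.exp (-((1 + 4 * M) * Real.log x)) ≤ 1 / (2 * x) := by
  have hx0 : 0 < x := by linarith
  have hlog : 1 / 2 ≤ Real.log x := by
    have h1 := Real.log_two_gt_d9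
    have h2 := Real.log_le_log two_pos hx
    linarith
  have e : Real.exp (-((1 + 4 * M) * Real.log x)) = (Real.exp (4 * M * Real.log x))⁻¹ / x := by
    rw [← Real.exp_neg, div_eq_mul_inv]
    conv_rhs => rw [← Real.exp_log hx0, ← Real.exp_neg, ← Real.exp_add, Real.log_exp]
    ring_nf
  have h2 : 2 * M ≤ Real.exp (4 * M * Real.log x) := by
    have := Real.add_one_le_exp (4 * M * Real.log x)
    nlinarith
  have hpos := Real.exp_pos (4 * M * Real.log x)
  rw [e, mul_div_assoc', ← div_eq_mul_inv, div_div, div_le_div_iff₀ (by positivity) (by positivity)]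
  nlinarith

/-- Both `2g` and `c exp y` bound the difference, hence so does `(c + 2g) exp (θy)` for any `θ` in
`(0, 1]`. The choice of `θ` makes `θvβ ≤ 1`, slowing the growth to `exp |s|` for every `β` while the
decay in `R` is divided by `(v+1)(β+1)`. -/
theorem norm_evolve_sub_scaled_le {n : Type*} [Fintype n] [DecidableEq n] {H H' A : Matrix n n ℂ}
    (hH : H.IsHermitian) (hH' : H'.IsHermitian) {c v g β R : ℝ} (hc : 0 ≤ c) (hv : 0 ≤ v)
    (hβ : 0 < β) (hA : ‖A‖ ≤ g)
    (h : ∀ t, ‖evolve H t A - evolve H' t A‖ ≤ c * Real.exp (v * |t| - R)) (s : ℝ) :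
    ‖evolve H (β * s) A - evolve H' (β * s) A‖ ≤
      (c + 2 * g) * Real.exp (-(R / ((v + 1) * (β + 1)))) * Real.exp |s| := by
  have hg : 0 ≤ g := (norm_nonneg _).trans hA
  set θ := 1 / ((v + 1) * (β + 1)) with hθ
  have hden : 0 < (v + 1) * (β + 1) := by positivity
  have hθ0 : 0 < θ := by positivity
  have hθ1 : θ ≤ 1 := by
    rw [hθ, div_le_one hden]
    nlinarith [mul_nonneg hv hβ.le]
  have hθv : θ * (v * β) ≤ 1 := by
    rw [hθ, one_div_mul_eq_div, div_le_one hden]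
    nlinarith
  set y := v * |β * s| - R with hy
  have h1 : ‖evolve H (β * s) A - evolve H' (β * s) A‖ ≤ (c + 2 * g) * Real.exp (θ * y) := by
    rcases le_total 0 y with h0 | h0
    · have h2 : ‖evolve H (β * s) A - evolve H' (β * s) A‖ ≤ g + g :=
        (norm_sub_le _ _).trans (add_le_add ((norm_evolve_le hH _ _).trans hA)
          ((norm_evolve_le hH' _ _).trans hA))
      have h3 : 1 ≤ Real.exp (θ * y) := Real.one_le_exp (mul_nonneg hθ0.le h0)
      nlinarith
    · have h3 : Real.exp y ≤ Real.exp (θ * y) := Real.exp_le_exp.2 (by nlinarith)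
      refine (h (β * s)).trans ?_
      have := Real.exp_pos y
      nlinarith
  refine h1.trans ?_
  rw [mul_assoc, ← Real.exp_add]
  refine mul_le_mul_of_nonneg_left (Real.exp_le_exp.2 ?_) (by positivity)
  have e : R / ((v + 1) * (β + 1)) = θ * R := by rw [hθ, one_div_mul_eq_div]
  rw [e, hy, abs_mul, abs_of_pos hβ]
  nlinarith [mul_le_mul_of_nonneg_right hθv (abs_nonneg s)]

end QGibbs

end

theorem mainTheorem10 (r k : ℕ) (g κ : ℝ) :
    ∃ C : ℝ, 0 < C ∧
      ∀ (Λ : Finset (Fin r → ℤ)) (h : Finset Λ → QGibbs.Op Λ) (J : ℕ)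
        (X : Fin J → Finset Λ) (A : Fin J → QGibbs.Op Λ) (β ε R : ℝ),
        QGibbs.IsLocalInteraction k g h → QGibbs.IsLocalJumps k g X A →
        0 < β → 0 < ε → 2 * ε ≤ J → R = C * ((β + 1) * Real.log (J / ε)) →
        ∃ (p q : ℕ) (B : Fin p → QGibbs.Op Λ) (L : Fin q → QGibbs.Op Λ),
          (∀ j, (B j).IsHermitian) ∧
          (∀ j, ∃ a, QGibbs.ActsOn (B j) (QGibbs.nbhd R (X a))) ∧
          (∀ i, ∃ a, QGibbs.ActsOn (L i) (QGibbs.nbhd R (X a))) ∧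
          QGibbs.diamondNorm (fun ρ =>
            QGibbs.chenLindbladian κ (∑ Z, h Z) β A ρ - QGibbs.lindbladian B L ρ)
              ≤ ENNReal.ofReal ε ∧
          ∃ δ₀ : ℝ, 0 < δ₀ ∧ ∀ δ : ℝ, 0 < δ → δ ≤ δ₀ →
            ∃ (m : ℕ) (K : Fin m → QGibbs.Op Λ),
              ∑ i, (K i).conjTranspose * K i = 1 ∧
              (∀ i, ∃ a, QGibbs.ActsOn (K i) (QGibbs.nbhd R (X a))) ∧
              QGibbs.diamondNorm (fun ρ =>
                ρ + (δ : ℂ) • QGibbs.chenLindbladian κ (∑ Z, h Z) β A ρ - QGibbs.krausMap K ρ)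
                  ≤ ENNReal.ofReal (δ * ε) := by
  open QGibbs in
  -- For negative `g` no interaction satisfies the norm bound, already at the empty set, so any
  -- constant works.
  rcases lt_or_ge g 0 with hg | hg
  · refine ⟨1, one_pos, fun Λ h J X A β ε R hh => ?_⟩
    exact absurd ((norm_nonneg _).trans (hh.norm_le ∅)) (not_le.2 hg)
  obtain ⟨c, v, hc, hv, hLR⟩ := exists_norm_evolve_sub_evolve_truncHam_le r k hg
  set K₁ := 4 * |κ| * g * coherentConst + 4 * g * filterConst ^ 2 * √(2 * Real.pi) with hK₁
  have hK₁0 : 0 ≤ K₁ := by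
    have := coherentConst_nonneg
    positivity
  set M := K₁ * (c + 2 * g) with hM
  have hM0 : 0 ≤ M := by positivity
  -- The factor `v + 1` cancels the velocity in the interpolated decay rate; `1 + 4M` is the
  -- exponent required by `exp_neg_mul_log_le`.
  refine ⟨(v + 1) * (1 + 4 * M), by positivity, ?_⟩
  intro Λ h J X A β ε R hh hA hβ hε hJε hR
  have hJ' : (0 : ℝ) < J := by linarith
  have hx : 2 ≤ (J : ℝ) / ε := by rwa [le_div_iff₀ hε]
  have hlog : 0 ≤ Real.log (J / ε) := Real.log_nonneg (by linarith)
  have hR0 : 0 ≤ R := by rw [hR]; positivity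
  have hH : (∑ Z, h Z).IsHermitian := isHermitian_sum _ hh.isHermitian
  have hAS : ∀ a, A a ∈ localOps (nbhd R (X a)) := fun a =>
    (hA.actsOn a).mono (subset_nbhd hR0 (X a))
  have hbound : ∀ a, DiamondBound (fun ρ => chenTerm κ (∑ Z, h Z) β (A a) ρ -
      chenTerm κ (truncHam h (nbhd R (X a))) β (A a) ρ) (ε / (2 * J)) := fun a => by
    have hH' := truncHam_isHermitian hh (nbhd R (X a))
    have hq := norm_evolve_sub_scaled_le hH hH' hc hv hβ (hA.norm_le a)
      (hLR Λ h (X a) (A a) R hh (hA.card_le a) (hA.actsOn a) (hA.norm_le a))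
    refine (diamondBound_chenTerm_sub κ hH hH' hβ (hA.norm_le a) hq).mono ?_
    have e : R / ((v + 1) * (β + 1)) = (1 + 4 * M) * Real.log (J / ε) := by
      rw [hR]
      field_simp
    rw [e, ← mul_assoc, ← hK₁, ← hM]
    refine (exp_neg_mul_log_le hM0 hx).trans_eq ?_
    field_simp
  choose B L hB hBS hLS hBL using fun a => exists_local_chenTerm_eq κ
    (truncHam_isHermitian hh (nbhd R (X a))) (truncHam_mem_localOps hh _) (hAS a) hβ
  simp only [hBL] at hbound
  have := exists_lindbladian_and_channel (by exact_mod_cast hJ') hB hBS hLS hε hbound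
  simpa only [chenLindbladian_eq_sum] using this
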